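/- Let $d\in\mathbb N$. A matrix weight is a function $V$ from $\mathbb R$ to the complex $d\times d$ matrices whose entries are locally integrable and such that $V(x)$ is positive definite for almost every $x$. Write $\langle g\rangle_I=\frac1{|I|}\int_I g(y)\,dy$ and let $\|\cdot\|$ be the Euclidean norm on $\mathbb C^d$ and the operator norm of matrices acting on $\mathbb C^d$. A matrix weight $V$ is a matrix $A_2$ weight if $V^{-1}$ is also a matrix weight and $$[V]_{A_2}=\sup_I\big\|\langle V\rangle_I^{1/2}\langle V^{-1}\rangle_I^{1/2}\big\|^2<\infty,$$ the supremum being over all bounded nondegenerate intervals $I\subset\mathbb R$. Let $\mathcal D$ be the set of dyadic intervals $[k2^n,(k+1)2^n)$, $k,n\in\mathbb Z$, and put, for $f\in L^2(\mathbb R,\mathbb C^d)$, $$M_Vf(x)=\sup_{I\in\mathcal D,\;x\in I}\big\|\langle V\rangle_I^{-1/2}\langle V^{1/2}f\rangle_I\big\|,\qquad \widetilde M_Vf(x)=\sup_{I\in\mathcal D,\;x\in I}\frac1{|I|}\int_I\big\|\langle V\rangle_I^{1/2}V^{-1/2}(y)f(y)\big\|\,dy .$$ (i) There is a constant $C$,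 depending only on $d$, such that for every matrix $A_2$ weight $V$ and every $f\in L^2(\mathbb R,\mathbb C^d)$ one has $M_Vf\in L^2(\mathbb R)$ and $\|M_Vf\|_{L^2}\le C\,[V]_{A_2}\,\|f\|_{L^2}$; that is, $\|M_V\|_{L^2\to L^2}\lesssim[V]_{A_2}$ with implied constant depending only on $d$. (ii) If $W$ and $W^{-1}$ are both matrix weights (in particular, if $W$ is a matrix $A_2$ weight), then $M_Wf(x)\le\widetilde M_{W^{-1}}f(x)$ for every $f\in L^2(\mathbb R,\mathbb C^d)$ and every $x\in\mathbb R$. -/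

import Mathlib

open MeasureTheory
open scoped ENNReal NNReal

noncomputable section

namespace MatrixWeight

open scoped ComplexOrder MatrixOrder Matrix.Norms.L2Operator

/-- A `d × d` matrix weight on `ℝ`: the entries are locally integrable and the matrix is
positive definite almost everywhere. -/
structure IsMatrixWeight {d : ℕ} (V : ℝ → Matrix (Fin d) (Fin d) ℂ) : Prop where
  locallyIntegrable : ∀ i j, LocallyIntegrable (fun x => V x i j) volume
  posDef : ∀ᵐ x ∂(volume : Measure ℝ), (V x).PosDef

/-- The entrywise average of a matrix-valued function over a set `I`. -/
def matAvg {d : ℕ} (V : ℝ → Matrix (Fin d) (Fin d) ℂ) (I : Set ℝ) :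
    Matrix (Fin d) (Fin d) ℂ :=
  Matrix.of fun i j => ⨍ x in I, V x i j

/-- The action of a matrix on a vector of `ℂ^d`, the latter with its Euclidean norm. -/
def act {d : ℕ} (A : Matrix (Fin d) (Fin d) ℂ) (v : EuclideanSpace ℂ (Fin d)) :
    EuclideanSpace ℂ (Fin d) :=
  WithLp.toLp 2 (A.mulVec v.ofLp)

/-- The `A₂` characteristic: the supremum over all bounded nondegenerate intervals `I` of
the squared operator norm of `⟨V⟩_I^{1/2} ⟨V⁻¹⟩_I^{1/2}`.
Here `‖·‖ₑ` is the (extended) operator norm of a matrix acting on the Hilbert space `ℂ^d`. -/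
def a2Char {d : ℕ} (V : ℝ → Matrix (Fin d) (Fin d) ℂ) : ℝ≥0∞ :=
  ⨆ (a : ℝ) (b : ℝ) (_ : a < b),
    ‖CFC.sqrt (matAvg V (Set.Ico a b)) *
      CFC.sqrt (matAvg (fun x => (V x)⁻¹) (Set.Ico a b))‖ₑ ^ 2

/-- A matrix `A₂` weight. The second field makes the averages of `V⁻¹` in the characteristic
meaningful (where they are infinite, so is the characteristic). -/
structure IsMatrixA2Weight {d : ℕ} (V : ℝ → Matrix (Fin d) (Fin d) ℂ) : Prop where
  isMatrixWeight : IsMatrixWeight V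
  isMatrixWeight_inv : IsMatrixWeight fun x => (V x)⁻¹
  a2Char_lt_top : a2Char V < ∞

/-- The dyadic interval `[k 2^n, (k+1) 2^n)`. -/
def dyadic (n k : ℤ) : Set ℝ :=
  Set.Ico ((k : ℝ) * 2 ^ n) (((k : ℝ) + 1) * 2 ^ n)

/-- The maximal function `M_V f (x) = sup_I ‖⟨V⟩_I^{-1/2} ⟨V^{1/2} f⟩_I‖ 1_I(x)`, the supremum
being over all dyadic intervals. -/
def maximalFn {d : ℕ} (V : ℝ → Matrix (Fin d) (Fin d) ℂ)
    (f : ℝ → EuclideanSpace ℂ (Fin d)) (x : ℝ) : ℝ≥0∞ :=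
  ⨆ (n : ℤ) (k : ℤ), (dyadic n k).indicator
    (fun _ => ‖act (CFC.sqrt (matAvg V (dyadic n k)))⁻¹
      (⨍ y in dyadic n k, act (CFC.sqrt (V y)) (f y))‖ₑ) x

/-- The auxiliary maximal function
`sup_I (1/|I|) ∫_I ‖⟨V⟩_I^{1/2} V^{-1/2}(y) f(y)‖ dy`, the supremum being over all dyadic
intervals containing `x`. -/
def auxMaximalFn {d : ℕ} (V : ℝ → Matrix (Fin d) (Fin d) ℂ)
    (f : ℝ → EuclideanSpace ℂ (Fin d)) (x : ℝ) : ℝ≥0∞ :=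
  ⨆ (n : ℤ) (k : ℤ) (_ : x ∈ dyadic n k),
    ⨍⁻ y in dyadic n k, ‖act (CFC.sqrt (matAvg V (dyadic n k)) * (CFC.sqrt (V y))⁻¹) (f y)‖ₑ ∂volume

end MatrixWeight

end

/-! Everything rests on Cauchy–Schwarz for a positive definite matrix, $|\langle
e,u\rangle|^2\le\langle Ve,e\rangle\langle V^{-1}u,u\rangle$, integrated over a set
(`measure_mul_inner_sq_le`). Testing it on a whole interval gives $\langle V\rangle_I^{-1}\le\langle
V^{-1}\rangle_I$, from which (ii) follows by moving the norm inside the average. Testing it on half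
of an interval shows that every scalar weight $\langle Ve,e\rangle$ is doubling in the sense
$w(I)\le4Qw(E)$ whenever $|I|\le2|E|$, where $Q=[V]_{A_2}$.

For (i), let $\varphi_I$ and $v_I^{1/2}$ be the Hilbert–Schmidt norms of $\langle
V\rangle_I^{-1/2}V^{1/2}$ and $\langle V\rangle_I^{1/2}V^{-1/2}$, and put $F=\|f\|$. Then $M_Vf$ is
at most the supremum of the averages $a_I=\langle\varphi_IF\rangle_I$. Only three facts about
$\varphi_I$ matter (`WeightFamily`): $\int_I\varphi_I^2\le d|I|$, doubling of $\varphi_I^2$, and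
$\varphi_J^2\le\langle v_I\rangle_J\varphi_I^2$ with $\langle v_I\rangle_I\le dQ$.

Stop at $J$ below a stopping interval $I$ when $\langle v_I\rangle_J>4dQ$ or
$\langle\varphi_IF\rangle_J>4a_I$. By the weak type inequality the later stops fill at most half of
$I$. An interval with last stop $I$ has $a_J^2\le64dQ\,a_I^2$, so it remains to bound $X=\sum
a_I^2|I|$ over the stopping intervals by $16dQ\|F\|_2^2$ (`lintegral_stopSum_le`). By duality
$X\le\int Fg$ with $g=\sum a_I\varphi_I1_I$, and it suffices that $\|g\|_2^2\le16dQ\,X$. This is a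
Schur test: doubling makes the mass of $\varphi_I^2$ on successive generations of stops decay by
$1-1/(4Q)$, so off-diagonal products may be weighted geometrically with ratio $r=1-1/(8Q)$.
Comparison with the last stop and the Carleson embedding each cost $Q$ in the squared norm, hence
$Q$ in the norm. -/

noncomputable section

namespace MatrixWeight

/-! ### Geometrically weighted tail sums -/

/-- The sum of `b n` over `m ≤ n < m + j` with `u n`, the `i`-th of these terms being
weighted by `ρ ^ i`. -/
def geomTail (ρ : ℝ≥0∞) (u : ℕ → Prop) (b : ℕ → ℝ≥0∞) : ℕ → ℕ → ℝ≥0∞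
  | 0, _ => 0
  | j + 1, m => open Classical in
      if u m then b m + ρ * geomTail ρ u b j (m + 1) else geomTail ρ u b j (m + 1)

/-- The sum over `m ≤ n < m + j` with `u n` of `b n` times the weighted number of later indices. -/
def schurTail (t : ℝ≥0∞) (u : ℕ → Prop) (b : ℕ → ℝ≥0∞) : ℕ → ℕ → ℝ≥0∞
  | 0, _ => 0
  | j + 1, m => open Classical in
      (if u m then b m * geomTail t u (fun _ => 1) (j + 1) m else 0) + schurTail t u b j (m + 1)

lemma ennreal_two_mul_le_add_sq (a b : ℝ≥0∞) : 2 * a * b ≤ a ^ 2 + b ^ 2 := by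
  by_cases ha : a = ∞
  · simp [ha]
  by_cases hb : b = ∞
  · simp [hb]
  lift a to ℝ≥0 using ha
  lift b to ℝ≥0 using hb
  exact_mod_cast two_mul_le_add_sq a b

/-- Termwise weighted AM–GM: $2cb_n\le t^ic^2+r^ib_n^2$ for the $i$-th active index, as $rt=1$. -/
lemma two_mul_geomTail_le {r t : ℝ≥0∞} (hrt : r * t = 1) (u : ℕ → Prop) (b : ℕ → ℝ≥0∞)
    (j : ℕ) : ∀ (m : ℕ) (c : ℝ≥0∞), 2 * c * geomTail 1 u b j m ≤
      c ^ 2 * geomTail t u (fun _ => 1) j m + geomTail r u (fun n => b n ^ 2) j m := by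
  induction j with
  | zero => intro m c; simp [geomTail]
  | succ j ih =>
    intro m c
    by_cases hu : u m
    · simp only [geomTail, hu, if_true]
      set g := geomTail 1 u b j (m + 1)
      set Z := geomTail t u (fun _ => 1) j (m + 1)
      set Y := geomTail r u (fun n => b n ^ 2) j (m + 1)
      -- Inserting $rt=1$ replaces $c$ by $ct$ with an outer factor $r$, and $r(ct)^2=tc^2$.
      have h1 : 2 * c * g ≤ c ^ 2 * (t * Z) + r * Y := by
        calc 2 * c * g = (r * t) * (2 * c * g) := by rw [hrt, one_mul]
          _ = r * (2 * (c * t) * g) := by ring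
          _ ≤ r * ((c * t) ^ 2 * Z + Y) := by gcongr; exact ih (m + 1) (c * t)
          _ = (r * t) * (c ^ 2 * (t * Z)) + r * Y := by ring
          _ = _ := by rw [hrt, one_mul]
      calc 2 * c * (b m + 1 * g) = 2 * c * b m + 2 * c * g := by ring
        _ ≤ (c ^ 2 + b m ^ 2) + (c ^ 2 * (t * Z) + r * Y) :=
          add_le_add (ennreal_two_mul_le_add_sq _ _) h1
        _ = _ := by ring
    · simp only [geomTail, hu, if_false]
      exact ih (m + 1) c

/-- Expand the square and apply weighted AM–GM to each $b_mb_n$. Each $b_n^2$ is charged by the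
active indices at or before $n$ with weights $r^i$, in total at most $L=1/(1-r)$. The extra
left-hand term is the part of this budget reserved for indices still to be prepended, which lets the
induction close through $Lr+1=L$. -/
lemma geomTail_sq_le {r t L : ℝ≥0∞} (hrt : r * t = 1) (hL : L * r + 1 = L)
    (u : ℕ → Prop) (b : ℕ → ℝ≥0∞) (j : ℕ) : ∀ m : ℕ,
    geomTail 1 u b j m ^ 2 + L * r * geomTail r u (fun n => b n ^ 2) j m ≤
      schurTail t u (fun n => b n ^ 2) j m + L * geomTail 1 u (fun n => b n ^ 2) j m := by
  induction j with
  | zero => intro m; simp [geomTail]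
  | succ j ih =>
    intro m
    have key := two_mul_geomTail_le hrt u b (j + 1) m (b m)
    have ih' := ih (m + 1)
    by_cases hu : u m
    · simp only [schurTail]
      set Z := geomTail t u (fun _ => 1) (j + 1) m
      simp only [geomTail, hu, if_true] at key ⊢
      set g := geomTail 1 u b j (m + 1)
      set Y := geomTail r u (fun n => b n ^ 2) j (m + 1)
      set s := geomTail 1 u (fun n => b n ^ 2) j (m + 1)
      set R := schurTail t u (fun n => b n ^ 2) j (m + 1)
      calc (b m + 1 * g) ^ 2 + L * r * (b m ^ 2 + r * Y)
          ≤ (2 * b m * (b m + 1 * g) + g ^ 2) + L * r * (b m ^ 2 + r * Y) := by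
            gcongr
            calc (b m + 1 * g) ^ 2 = b m ^ 2 + 2 * b m * g + g ^ 2 := by ring
              _ ≤ (b m ^ 2 + 2 * b m * g + g ^ 2) + b m ^ 2 := le_self_add
              _ = _ := by ring
        _ ≤ ((b m ^ 2 * Z + (b m ^ 2 + r * Y)) + g ^ 2) + L * r * (b m ^ 2 + r * Y) := by
            gcongr
        _ = b m ^ 2 * Z + (L * r + 1) * (b m ^ 2 + r * Y) + g ^ 2 := by ring
        _ = b m ^ 2 * Z + L * b m ^ 2 + (g ^ 2 + L * r * Y) := by rw [hL]; ring
        _ ≤ b m ^ 2 * Z + L * b m ^ 2 + (R + L * s) := by gcongr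
        _ = _ := by ring
    · simp only [schurTail, geomTail, hu, if_false, zero_add]
      exact ih'

/-! ### Stopping levels -/

/-- The level of the last stopping cell at `x` up to level `n`, when stopping is governed by
the relation `bad`. -/
def lastStop (bad : ℕ → ℕ → α → Prop) : ℕ → α → ℕ
  | 0, _ => 0
  | n + 1, x => open Classical in
      if bad (lastStop bad n x) (n + 1) x then n + 1 else lastStop bad n x

/-- The union of the stopping cells of level `n`. -/
def stopSet (bad : ℕ → ℕ → α → Prop) (n : ℕ) : Set α := {x | lastStop bad n x = n}

variable {α : Type*} {bad : ℕ → ℕ → α → Prop}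

lemma lastStop_le (n : ℕ) (x : α) : lastStop bad n x ≤ n := by
  induction n with
  | zero => simp [lastStop]
  | succ n ih => rw [lastStop]; split_ifs <;> omega

lemma mem_stopSet_lastStop (n : ℕ) (x : α) : x ∈ stopSet bad (lastStop bad n x) := by
  induction n with
  | zero => simp [lastStop, stopSet]
  | succ n ih =>
    by_cases h : bad (lastStop bad n x) (n + 1) x
    · have : lastStop bad (n + 1) x = n + 1 := by rw [lastStop, if_pos h]
      rw [this]; exact this
    · have : lastStop bad (n + 1) x = lastStop bad n x := by rw [lastStop, if_neg h]
      rw [this]; exact ih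

lemma lastStop_eq_or_not_bad (n : ℕ) (x : α) :
    lastStop bad n x = n ∨ ¬ bad (lastStop bad n x) n x := by
  cases n with
  | zero => simp [lastStop]
  | succ n =>
    by_cases h : bad (lastStop bad n x) (n + 1) x
    · left; rw [lastStop, if_pos h]
    · right; rwa [lastStop, if_neg h]

/-- The first stop after level $m$ is judged against $m$ itself, so every later stop, of whatever
generation, lies under a cell that is bad relative to $m$. -/
lemma exists_bad_of_mem_stopSet {m n : ℕ} (hmn : m < n) {x : α} (hm : x ∈ stopSet bad m)
    (hn : x ∈ stopSet bad n) : ∃ k, m < k ∧ k ≤ n ∧ bad m k x := by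
  by_contra! hcon
  have : ∀ k, m ≤ k → k ≤ n → lastStop bad k x = m := by
    intro k hk
    induction k, hk using Nat.le_induction with
    | base => intro _; exact hm
    | succ k hk ih =>
      intro hkn
      have := ih (by omega)
      rw [lastStop, this, if_neg (hcon (k + 1) (by omega) hkn)]
  have h1 := this n hmn.le le_rfl
  have h2 : lastStop bad n x = n := hn
  omega

/-! ### Nested partitions -/

variable [MeasurableSpace α]

/-- A sequence of countable partitions, each refining the previous one, into cells of positive
finite measure. -/
structure NestedPartition (μ : Measure α) where
  idx : ℕ → α → ℤ
  measurable_idx : ∀ m, Measurable (idx m)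
  nested : ∀ m x y, idx (m + 1) x = idx (m + 1) y → idx m x = idx m y
  pos : ∀ m c, μ (idx m ⁻¹' {c}) ≠ 0
  lt_top : ∀ m c, μ (idx m ⁻¹' {c}) ≠ ∞

namespace NestedPartition

variable {μ : Measure α} (P : NestedPartition μ)

/-- The cell of the `m`-th partition with index `c`. -/
def cell (m : ℕ) (c : ℤ) : Set α := P.idx m ⁻¹' {c}

lemma mem_cell {m : ℕ} {c : ℤ} {x : α} : x ∈ P.cell m c ↔ P.idx m x = c := Iff.rfl

lemma measurableSet_cell (m : ℕ) (c : ℤ) : MeasurableSet (P.cell m c) :=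
  P.measurable_idx m (measurableSet_singleton c)

lemma measure_cell_ne_zero (m : ℕ) (c : ℤ) : μ (P.cell m c) ≠ 0 := P.pos m c

lemma measure_cell_ne_top (m : ℕ) (c : ℤ) : μ (P.cell m c) ≠ ∞ := P.lt_top m c

lemma idx_eq_of_le {m n : ℕ} (h : m ≤ n) {x y : α} (hxy : P.idx n x = P.idx n y) :
    P.idx m x = P.idx m y := by
  induction n, h using Nat.le_induction with
  | base => exact hxy
  | succ n _ ih => exact ih (P.nested n x y hxy)

lemma cell_subset {m n : ℕ} (h : m ≤ n) (x : α) :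
    P.cell n (P.idx n x) ⊆ P.cell m (P.idx m x) :=
  fun _ hy => P.idx_eq_of_le h hy

lemma cell_subset_or_disjoint {m n : ℕ} (h : m ≤ n) (c c' : ℤ) :
    P.cell n c' ⊆ P.cell m c ∨ Disjoint (P.cell n c') (P.cell m c) := by
  by_cases hd : Disjoint (P.cell n c') (P.cell m c)
  · exact Or.inr hd
  · obtain ⟨x, hx, hx'⟩ := Set.not_disjoint_iff.1 hd
    left
    intro y hy
    rw [mem_cell] at *
    rw [← hx']
    exact P.idx_eq_of_le h (hy.trans hx.symm)

lemma lintegral_eq_tsum (ν : Measure α) (m : ℕ) (f : α → ℝ≥0∞) :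
    ∫⁻ x, f x ∂ν = ∑' c, ∫⁻ x in P.cell m c, f x ∂ν := by
  rw [← lintegral_iUnion (P.measurableSet_cell m)]
  · have : ⋃ c, P.cell m c = Set.univ := by
      ext x; simp [mem_cell]
    rw [this, Measure.restrict_univ]
  · intro c c' hcc
    refine Set.disjoint_left.2 fun x hx hx' => hcc ?_
    rw [mem_cell] at hx hx'
    exact hx.symm.trans hx'

lemma lintegral_mono_of_cells (m : ℕ) {f g : α → ℝ≥0∞}
    (h : ∀ c, ∫⁻ x in P.cell m c, f x ∂μ ≤ ∫⁻ x in P.cell m c, g x ∂μ) :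
    ∫⁻ x, f x ∂μ ≤ ∫⁻ x, g x ∂μ := by
  rw [P.lintegral_eq_tsum μ m f, P.lintegral_eq_tsum μ m g]
  exact ENNReal.tsum_le_tsum h

lemma setLIntegral_mono_of_subcells (m : ℕ) (c : ℤ) {f g : α → ℝ≥0∞}
    (h : ∀ c', P.cell (m + 1) c' ⊆ P.cell m c →
      ∫⁻ x in P.cell (m + 1) c', f x ∂μ ≤ ∫⁻ x in P.cell (m + 1) c', g x ∂μ) :
    ∫⁻ x in P.cell m c, f x ∂μ ≤ ∫⁻ x in P.cell m c, g x ∂μ := by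
  rw [P.lintegral_eq_tsum _ (m + 1) f, P.lintegral_eq_tsum _ (m + 1) g]
  refine ENNReal.tsum_le_tsum fun c' => ?_
  rw [Measure.restrict_restrict (P.measurableSet_cell _ _)]
  rcases P.cell_subset_or_disjoint (Nat.le_succ m) c c' with hs | hd
  · rw [Set.inter_eq_left.2 hs]
    exact h c' hs
  · simp [Set.disjoint_iff_inter_eq_empty.1 hd]

lemma measurable_comp_idx {β : Type*} [MeasurableSpace β] (m : ℕ) (g : ℤ → β) :
    Measurable fun x => g (P.idx m x) :=
  (measurable_from_top (f := g)).comp (P.measurable_idx m)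

lemma measurable_idx_apply (m : ℕ) {g : ℤ → α → ℝ≥0∞} (hg : ∀ c, Measurable (g c)) :
    Measurable fun x => g (P.idx m x) x := by
  have : Measurable (Function.uncurry g) := measurable_from_prod_countable_right hg
  exact this.comp ((P.measurable_idx m).prodMk measurable_id)

/-- The weak type inequality for the maximal function of a nested partition. -/
lemma weak_type (h : α → ℝ≥0∞) (t : ℝ≥0∞) (j : ℕ) : ∀ (m : ℕ) (c : ℤ),
    ∫⁻ x in P.cell m c, Set.indicator
      {x | ∃ n, m ≤ n ∧ n < m + j ∧ t < ⨍⁻ y in P.cell n (P.idx n x), h y ∂μ}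
      (fun _ => t) x ∂μ ≤ ∫⁻ x in P.cell m c, h x ∂μ := by
  induction j with
  | zero =>
    intro m c
    have : {x | ∃ n, m ≤ n ∧ n < m + 0 ∧ t < ⨍⁻ y in P.cell n (P.idx n x), h y ∂μ} = ∅ := by
      ext x; simp; intro n h1 h2; omega
    simp only [this, Set.indicator_empty]
    simp
  | succ j ih =>
    intro m c
    by_cases hc : t < ⨍⁻ y in P.cell m c, h y ∂μ
    · calc _ ≤ ∫⁻ x in P.cell m c, t ∂μ :=
            lintegral_mono fun x => Set.indicator_le_self _ _ x
        _ = t * μ (P.cell m c) := setLIntegral_const _ _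
        _ ≤ (⨍⁻ y in P.cell m c, h y ∂μ) * μ (P.cell m c) := by gcongr
        _ = _ := by
          rw [setLAverage_eq, ENNReal.div_mul_cancel (P.measure_cell_ne_zero m c)
            (P.measure_cell_ne_top m c)]
    · calc _ = ∫⁻ x in P.cell m c, Set.indicator
            {x | ∃ n, m + 1 ≤ n ∧ n < m + 1 + j ∧ t < ⨍⁻ y in P.cell n (P.idx n x), h y ∂μ}
            (fun _ => t) x ∂μ := by
            refine setLIntegral_congr_fun (P.measurableSet_cell m c) fun x hx => ?_
            have : (∃ n, m ≤ n ∧ n < m + (j + 1) ∧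
                t < ⨍⁻ y in P.cell n (P.idx n x), h y ∂μ) ↔
                (∃ n, m + 1 ≤ n ∧ n < m + 1 + j ∧
                t < ⨍⁻ y in P.cell n (P.idx n x), h y ∂μ) := by
              constructor
              · rintro ⟨n, h1, h2, h3⟩
                refine ⟨n, ?_, by omega, h3⟩
                rcases h1.eq_or_lt with rfl | h1
                · rw [(P.mem_cell).1 hx] at h3
                  exact absurd h3 hc
                · exact h1
              · rintro ⟨n, h1, h2, h3⟩
                exact ⟨n, by omega, by omega, h3⟩
            simp only [Set.indicator, Set.mem_ofPred_eq]
            by_cases hB : ∃ n, m ≤ n ∧ n < m + (j + 1) ∧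
                t < ⨍⁻ y in P.cell n (P.idx n x), h y ∂μ
            · rw [if_pos hB, if_pos (this.1 hB)]
            · rw [if_neg hB, if_neg (mt this.2 hB)]
        _ ≤ _ := P.setLIntegral_mono_of_subcells m c fun c' _ => ih (m + 1) c'

lemma measurableSet_maximal (h : α → ℝ≥0∞) (t : ℝ≥0∞) (m j : ℕ) : MeasurableSet
    {x | ∃ n, m ≤ n ∧ n < m + j ∧ t < ⨍⁻ y in P.cell n (P.idx n x), h y ∂μ} := by
  simp only [Set.ofPred_exists]
  refine MeasurableSet.iUnion fun n => ?_
  refine (MeasurableSet.const _).inter ((MeasurableSet.const _).inter ?_)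
  exact measurableSet_lt measurable_const
    (P.measurable_comp_idx n fun c => ⨍⁻ y in P.cell n c, h y ∂μ)

lemma measure_maximal_le (h : α → ℝ≥0∞) {t : ℝ≥0∞} (j m : ℕ) (c : ℤ) {s : ℝ≥0∞}
    (ht0 : t ≠ 0) (ht : t ≠ ∞) (hs : s * ⨍⁻ y in P.cell m c, h y ∂μ ≤ t) :
    s * μ (P.cell m c ∩
      {x | ∃ n, m ≤ n ∧ n < m + j ∧ t < ⨍⁻ y in P.cell n (P.idx n x), h y ∂μ}) ≤
      μ (P.cell m c) := by
  set B := {x | ∃ n, m ≤ n ∧ n < m + j ∧ t < ⨍⁻ y in P.cell n (P.idx n x), h y ∂μ} with hB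
  have h1 := P.weak_type h t j m c
  rw [lintegral_indicator_const (P.measurableSet_maximal h t m j),
    Measure.restrict_apply (P.measurableSet_maximal h t m j), ← hB, Set.inter_comm] at h1
  have h2 : t * (s * μ (P.cell m c ∩ B)) ≤ t * μ (P.cell m c) := by
    calc t * (s * μ (P.cell m c ∩ B)) = s * (t * μ (P.cell m c ∩ B)) := by ring
      _ ≤ s * ∫⁻ x in P.cell m c, h x ∂μ := by gcongr
      _ = (s * ⨍⁻ y in P.cell m c, h y ∂μ) * μ (P.cell m c) := by
        rw [setLAverage_eq, mul_assoc, ENNReal.div_mul_cancel (P.measure_cell_ne_zero m c)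
            (P.measure_cell_ne_top m c)]
      _ ≤ _ := by gcongr
  exact (ENNReal.mul_le_mul_iff_right ht0 ht).1 h2

/-! ### Stopping cells -/

/-- Badness at level $n$ depends only on the level-$n$ cell, hence so does the stopping history;
this makes the stopping sets measurable unions of cells. -/
lemma lastStop_eq_of_idx_eq
    (hbad : ∀ m n x y, m ≤ n → P.idx n x = P.idx n y → bad m n x → bad m n y)
    {n : ℕ} {x y : α} (h : P.idx n x = P.idx n y) : lastStop bad n x = lastStop bad n y := by
  induction n with
  | zero => rfl
  | succ n ih =>
    have e := ih (P.nested n x y h)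
    have : bad (lastStop bad n y) (n + 1) x ↔ bad (lastStop bad n y) (n + 1) y :=
      ⟨hbad _ _ _ _ (by have := lastStop_le (bad := bad) n y; omega) h,
        hbad _ _ _ _ (by have := lastStop_le (bad := bad) n y; omega) h.symm⟩
    by_cases hb : bad (lastStop bad n y) (n + 1) y
    · rw [lastStop, lastStop, if_pos hb, if_pos (by rw [e]; exact this.2 hb)]
    · rw [lastStop, lastStop, if_neg hb, if_neg (by rw [e]; exact fun hx => hb (this.1 hx)), e]

lemma cell_subset_stopSet_or_disjoint
    (hbad : ∀ m n x y, m ≤ n → P.idx n x = P.idx n y → bad m n x → bad m n y)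
    (n : ℕ) (c : ℤ) : P.cell n c ⊆ stopSet bad n ∨ Disjoint (P.cell n c) (stopSet bad n) := by
  by_cases hd : Disjoint (P.cell n c) (stopSet bad n)
  · exact Or.inr hd
  · obtain ⟨x, hx, hx'⟩ := Set.not_disjoint_iff.1 hd
    left
    intro y hy
    rw [mem_cell] at hx hy
    exact (P.lastStop_eq_of_idx_eq hbad (hy.trans hx.symm)).trans hx'

lemma measurableSet_stopSet
    (hbad : ∀ m n x y, m ≤ n → P.idx n x = P.idx n y → bad m n x → bad m n y)
    (n : ℕ) : MeasurableSet (stopSet bad n) := by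
  have : stopSet bad n = P.idx n ⁻¹' {c | P.cell n c ⊆ stopSet bad n} := by
    ext x
    constructor
    · intro hx
      rcases P.cell_subset_stopSet_or_disjoint hbad n (P.idx n x) with h | h
      · exact h
      · exact absurd hx (Set.disjoint_left.1 h rfl)
    · intro hx
      exact hx rfl
  rw [this]
  exact P.measurable_idx n (MeasurableSet.of_discrete)

/-- The set of points in a stopping cell of level `n` for some `m ≤ n < m + j`. -/
def laterStops (bad : ℕ → ℕ → α → Prop) (j m : ℕ) : Set α :=
  {x | ∃ n, m ≤ n ∧ n < m + j ∧ x ∈ stopSet bad n}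

lemma measurableSet_laterStops
    (hbad : ∀ m n x y, m ≤ n → P.idx n x = P.idx n y → bad m n x → bad m n y)
    (j m : ℕ) : MeasurableSet (laterStops bad j m) := by
  unfold laterStops
  simp only [Set.ofPred_exists]
  refine MeasurableSet.iUnion fun n => ?_
  exact (MeasurableSet.const _).inter
    ((MeasurableSet.const _).inter (P.measurableSet_stopSet hbad n))

lemma measurable_geomTail {U : ℕ → Set α} (hU : ∀ n, MeasurableSet (U n)) (ρ : ℝ≥0∞)
    {b : ℕ → α → ℝ≥0∞} (hb : ∀ n, Measurable (b n)) (j : ℕ) : ∀ m,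
    Measurable fun x => geomTail ρ (fun n => x ∈ U n) (fun n => b n x) j m := by
  induction j with
  | zero => intro m; simp only [geomTail]; exact measurable_const
  | succ j ih =>
    intro m
    simp only [geomTail]
    exact Measurable.ite (hU m) ((hb m).add (measurable_const.mul (ih _))) (ih _)

end NestedPartition

end MatrixWeight

end

/-! ### The Schur ratio, weight families and sparseness of the stopping cells. -/

noncomputable section

namespace MatrixWeight

lemma geomTail_one_succ (u : ℕ → Prop) (b : ℕ → ℝ≥0∞) (j m : ℕ) : open Classical in
    geomTail 1 u b (j + 1) m = (if u m then b m else 0) + geomTail 1 u b j (m + 1) := by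
  by_cases h : u m <;> simp [geomTail, h]

lemma le_geomTail_one {u : ℕ → Prop} {b : ℕ → ℝ≥0∞} {n : ℕ} (hn : u n) (j : ℕ) :
    ∀ m, m ≤ n → n < m + j → b n ≤ geomTail 1 u b j m := by
  induction j with
  | zero => intro m h1 h2; omega
  | succ j ih =>
    intro m h1 h2
    rw [geomTail_one_succ]
    rcases h1.eq_or_lt with rfl | h1
    · rw [if_pos hn]; exact le_self_add
    · exact (ih (m + 1) h1 (by omega)).trans le_add_self

/-- The ratio of the weights in the Schur test. -/
lemma exists_schur_ratio {Q : ℝ≥0} (hQ : 1 ≤ Q) : ∃ r t : ℝ≥0, r * t = 1 ∧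
    8 * Q * r + 1 = 8 * Q ∧ ∀ W B E : ℝ≥0, W = B + E → W ≤ 4 * Q * E →
      W + t * (8 * Q * B) ≤ 8 * Q * W := by
  obtain ⟨x, hx⟩ : ∃ x, 8 * Q = 1 + x :=
    exists_add_of_le (hQ.trans (le_mul_of_one_le_left zero_le (by norm_num)))
  have hx7 : 7 ≤ x := by
    have : (8 : ℝ≥0) ≤ 1 + x := by
      rw [← hx]; exact le_mul_of_one_le_right zero_le hQ
    have h : (1 : ℝ≥0) + 7 ≤ 1 + x := by norm_num at this ⊢; exact this
    exact (add_le_add_iff_left 1).1 h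
  have hx0 : x ≠ 0 := by rintro rfl; norm_num at hx7
  have hx1 : 1 + x ≠ 0 := by positivity
  -- With $8Q=1+x$ this is $r=1-1/(8Q)$. The decay condition reduces to $1-1/(4Q)\le r^2$, that is,
  -- $(x-1)(x+1)\le x^2$.
  refine ⟨x / (1 + x), (1 + x) / x, by field_simp, ?_, ?_⟩
  · rw [hx]; field_simp; ring
  · intro W B E hW hE
    have h2 : 2 * W ≤ (1 + x) * E := by
      rw [← hx]
      calc 2 * W ≤ 2 * (4 * Q * E) := by gcongr
        _ = _ := by ring
    rw [hx]
    have hxpos : (0 : ℝ) < x := by positivity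
    have h7 : (7 : ℝ) ≤ x := by exact_mod_cast hx7
    rw [← NNReal.coe_le_coe] at h2 ⊢
    have hW' : (W : ℝ) = B + E := by exact_mod_cast hW
    push_cast at h2 ⊢
    have hB : (0 : ℝ) ≤ B := B.2
    have key : (1 + (x : ℝ)) ^ 2 * B ≤ (x : ℝ) ^ 2 * W := by
      have h3 : (1 + (x : ℝ)) * B ≤ (x - 1) * W := by nlinarith
      have h4 : (1 + (x : ℝ)) * ((1 + x) * B) ≤ (1 + x) * ((x - 1) * W) := by gcongr
      have h5 : (0 : ℝ) ≤ W := W.2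
      nlinarith
    have h6 : (1 + (x : ℝ)) / x * ((1 + x) * B) ≤ x * W := by
      rw [div_mul_eq_mul_div, div_le_iff₀ hxpos]
      nlinarith
    linarith

lemma lintegral_mul_sq_le {α : Type*} [MeasurableSpace α] (ν : Measure α) {f g : α → ℝ≥0∞}
    (hf : AEMeasurable f ν) (hg : AEMeasurable g ν) :
    (∫⁻ x, f x * g x ∂ν) ^ 2 ≤ (∫⁻ x, f x ^ 2 ∂ν) * ∫⁻ x, g x ^ 2 ∂ν := by
  have h := ENNReal.lintegral_mul_le_Lp_mul_Lq ν Real.HolderConjugate.two_two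
    hf hg
  have h2 : ∀ z : ℝ≥0∞, (z ^ (1 / (2 : ℝ))) ^ 2 = z := fun z => by
    rw [← ENNReal.rpow_natCast, ← ENNReal.rpow_mul]; norm_num
  calc (∫⁻ x, f x * g x ∂ν) ^ 2
      ≤ ((∫⁻ x, f x ^ (2 : ℝ) ∂ν) ^ (1 / (2 : ℝ)) *
          (∫⁻ x, g x ^ (2 : ℝ) ∂ν) ^ (1 / (2 : ℝ))) ^ 2 := by gcongr; exact h
    _ = _ := by
      rw [mul_pow, h2, h2]
      simp

namespace NestedPartition

variable {α : Type*} [MeasurableSpace α] {μ : Measure α} (P : NestedPartition μ)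

lemma lintegral_stopSet_mono {bad : ℕ → ℕ → α → Prop}
    (hbad : ∀ m n x y, m ≤ n → P.idx n x = P.idx n y → bad m n x → bad m n y)
    (m : ℕ) {f g : α → ℝ≥0∞}
    (h : ∀ c, P.cell m c ⊆ stopSet bad m →
      ∫⁻ x in P.cell m c, f x ∂μ ≤ ∫⁻ x in P.cell m c, g x ∂μ) : open Classical in
    ∫⁻ x, (if x ∈ stopSet bad m then f x else 0) ∂μ ≤
      ∫⁻ x, (if x ∈ stopSet bad m then g x else 0) ∂μ := by
  refine P.lintegral_mono_of_cells m fun c => ?_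
  rcases P.cell_subset_stopSet_or_disjoint hbad m c with hc | hc
  · rw [setLIntegral_congr_fun (g := f) (P.measurableSet_cell m c)
      (fun x hx => if_pos (hc hx)),
      setLIntegral_congr_fun (g := g) (P.measurableSet_cell m c)
      (fun x hx => if_pos (hc hx))]
    exact h c hc
  · rw [setLIntegral_congr_fun (g := fun _ => 0) (P.measurableSet_cell m c)
      (fun x hx => if_neg (Set.disjoint_left.1 hc hx))]
    simp

/-- The summation over the stopping cells below a given cell, with geometrically growing
weights, of a measure which decays geometrically along the generations. -/
lemma setLIntegral_mul_geomTail_le {bad : ℕ → ℕ → α → Prop}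
    (hbad : ∀ m n x y, m ≤ n → P.idx n x = P.idx n y → bad m n x → bad m n y)
    {w : α → ℝ≥0∞} (hwm : Measurable w) {t L : ℝ≥0∞} {m₀ : ℕ} {c₀ : ℤ}
    (hw : ∀ n c j, P.cell n c ⊆ stopSet bad n → P.cell n c ⊆ P.cell m₀ c₀ →
      (∫⁻ x in P.cell n c, w x ∂μ) +
        t * (L * ∫⁻ x in P.cell n c ∩ laterStops bad j (n + 1), w x ∂μ) ≤
        L * ∫⁻ x in P.cell n c, w x ∂μ) (j : ℕ) :
    ∀ m c, P.cell m c ⊆ P.cell m₀ c₀ →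
      ∫⁻ x in P.cell m c, w x * geomTail t (fun n => x ∈ stopSet bad n) (fun _ => 1) j m ∂μ ≤
        ∫⁻ x in P.cell m c, L * (laterStops bad j m).indicator w x ∂μ := by
  have hU := fun n => P.measurableSet_stopSet hbad n
  have hB := fun j n => P.measurableSet_laterStops hbad j n
  induction j with
  | zero => intro m c _; simp [geomTail]
  | succ j ih =>
    intro m c hc
    -- The inductive bound keeps the indicator of later stops, so only the mass of $w$ on those
    -- stops is multiplied by $tL$, as `hw` requires.
    have hsub := P.setLIntegral_mono_of_subcells m c fun c' hc' => ih (m + 1) c' (hc'.trans hc)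
    rcases P.cell_subset_stopSet_or_disjoint hbad m c with hs | hs
    · have hZ := measurable_geomTail hU t (b := fun _ _ => 1) (fun _ => measurable_const) j (m + 1)
      calc _ = ∫⁻ x in P.cell m c, (w x + t * (w x *
              geomTail t (fun n => x ∈ stopSet bad n) (fun _ => 1) j (m + 1))) ∂μ := by
            refine setLIntegral_congr_fun (P.measurableSet_cell m c) fun x hx => ?_
            simp only [geomTail, if_pos (hs hx)]
            ring
        _ = (∫⁻ x in P.cell m c, w x ∂μ) + t * ∫⁻ x in P.cell m c, w x *
              geomTail t (fun n => x ∈ stopSet bad n) (fun _ => 1) j (m + 1) ∂μ := by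
            rw [lintegral_add_left hwm, lintegral_const_mul (t : ℝ≥0∞) (f := fun x => w x *
              geomTail t (fun n => x ∈ stopSet bad n) (fun _ => 1) j (m + 1)) (hwm.mul hZ)]
        _ ≤ (∫⁻ x in P.cell m c, w x ∂μ) +
              t * ∫⁻ x in P.cell m c, L * (laterStops bad j (m + 1)).indicator w x ∂μ := by
            gcongr
        _ = (∫⁻ x in P.cell m c, w x ∂μ) +
              t * (L * ∫⁻ x in P.cell m c ∩ laterStops bad j (m + 1), w x ∂μ) := by
            rw [lintegral_const_mul _ (hwm.indicator (hB _ _)), lintegral_indicator (hB _ _),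
              Measure.restrict_restrict (hB _ _), Set.inter_comm]
        _ ≤ L * ∫⁻ x in P.cell m c, w x ∂μ := hw m c j hs hc
        _ = ∫⁻ x in P.cell m c, L * w x ∂μ := (lintegral_const_mul _ hwm).symm
        _ = _ := by
            refine setLIntegral_congr_fun (P.measurableSet_cell m c) fun x hx => ?_
            rw [Set.indicator_of_mem]
            exact ⟨m, le_rfl, by omega, hs hx⟩
    · refine (setLIntegral_congr_fun (P.measurableSet_cell m c) fun x hx => ?_).trans_le
        (hsub.trans_eq (setLIntegral_congr_fun (P.measurableSet_cell m c) fun x hx => ?_))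
      · simp only [geomTail, if_neg (Set.disjoint_left.1 hs hx)]
      · congr 1
        have : x ∈ laterStops bad j (m + 1) ↔ x ∈ laterStops bad (j + 1) m := by
          constructor
          · rintro ⟨n, h1, h2, h3⟩
            exact ⟨n, by omega, by omega, h3⟩
          · rintro ⟨n, h1, h2, h3⟩
            rcases h1.eq_or_lt with rfl | h1
            · exact absurd h3 (Set.disjoint_left.1 hs hx)
            · exact ⟨n, h1, by omega, h3⟩
        by_cases hx' : x ∈ laterStops bad j (m + 1)
        · rw [Set.indicator_of_mem hx', Set.indicator_of_mem (this.1 hx')]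
        · rw [Set.indicator_of_notMem hx', Set.indicator_of_notMem (mt this.2 hx')]

/-- A family of functions `φ m c`, one for each cell of a nested partition, which behave like
the functions `‖⟨V⟩_I ^ (-1/2) * V ^ (1/2)‖` for a matrix `A₂` weight `V` of
characteristic at most `Q`. -/
structure WeightFamily (D Q : ℝ≥0) (φ v : ℕ → ℤ → α → ℝ≥0∞) : Prop where
  measurable : ∀ m c, Measurable (φ m c)
  one_le_left : 1 ≤ D
  one_le_right : 1 ≤ Q
  lintegral_sq_le : ∀ m c, ∫⁻ y in P.cell m c, φ m c y ^ 2 ∂μ ≤ D * μ (P.cell m c)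
  doubling : ∀ m c n c' E, MeasurableSet E → E ⊆ P.cell n c' → μ (P.cell n c') ≤ 2 * μ E →
    ∫⁻ y in P.cell n c', φ m c y ^ 2 ∂μ ≤ 4 * Q * ∫⁻ y in E, φ m c y ^ 2 ∂μ
  laverage_le : ∀ m c, ⨍⁻ y in P.cell m c, v m c y ∂μ ≤ D * Q
  compare : ∀ m c n c', ∀ᵐ y ∂μ, φ n c' y ^ 2 ≤ (⨍⁻ z in P.cell n c', v m c z ∂μ) * φ m c y ^ 2

namespace WeightFamily

variable {P} {D Q : ℝ≥0} {φ v : ℕ → ℤ → α → ℝ≥0∞}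

/-- The average of `φ m c * F` over the cell of index `c` of the `m`-th partition. -/
def cellAvg (P : NestedPartition μ) (φ : ℕ → ℤ → α → ℝ≥0∞) (F : α → ℝ≥0∞) (m : ℕ) (c : ℤ) :
    ℝ≥0∞ :=
  ⨍⁻ y in P.cell m c, φ m c y * F y ∂μ

/-- The stopping condition: relative to the earlier cell, either the weight or the average of `F`
has grown too much. -/
def badCell (P : NestedPartition μ) (D Q : ℝ≥0) (φ v : ℕ → ℤ → α → ℝ≥0∞) (F : α → ℝ≥0∞)
    (m n : ℕ) (x : α) : Prop :=
  (4 * D * Q : ℝ≥0∞) < ⨍⁻ y in P.cell n (P.idx n x), v m (P.idx m x) y ∂μ ∨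
    4 * cellAvg P φ F m (P.idx m x) <
      ⨍⁻ y in P.cell n (P.idx n x), φ m (P.idx m x) y * F y ∂μ

variable {F : α → ℝ≥0∞}

lemma badCell_congr (m n : ℕ) (x y : α) (hmn : m ≤ n) (h : P.idx n x = P.idx n y)
    (hx : badCell P D Q φ v F m n x) : badCell P D Q φ v F m n y := by
  unfold badCell at *
  rwa [← h, ← P.idx_eq_of_le hmn h]

variable (H : P.WeightFamily D Q φ v) (hF : Measurable F) (hF2 : ∫⁻ x, F x ^ 2 ∂μ ≠ ∞)

include H in
lemma setLIntegral_sq_ne_top {m n : ℕ} {c c' : ℤ} (h : P.cell n c' ⊆ P.cell m c) :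
    ∫⁻ y in P.cell n c', φ m c y ^ 2 ∂μ ≠ ∞ := by
  refine ne_top_of_le_ne_top ?_ ((lintegral_mono_set h).trans (H.lintegral_sq_le m c))
  exact ENNReal.mul_ne_top ENNReal.coe_ne_top (P.measure_cell_ne_top m c)

-- Cauchy–Schwarz together with $\int_I\varphi_I^2\le D\mu(I)$.
include H hF in
lemma cellAvg_sq_mul_measure_le (m : ℕ) (c : ℤ) :
    cellAvg P φ F m c ^ 2 * μ (P.cell m c) ≤ D * ∫⁻ x in P.cell m c, F x ^ 2 ∂μ := by
  have h0 := P.measure_cell_ne_zero m c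
  have h1 := P.measure_cell_ne_top m c
  have h := lintegral_mul_sq_le (μ.restrict (P.cell m c)) (H.measurable m c).aemeasurable
    hF.aemeasurable
  have e : cellAvg P φ F m c * μ (P.cell m c) = ∫⁻ y in P.cell m c, φ m c y * F y ∂μ := by
    rw [cellAvg, setLAverage_eq, ENNReal.div_mul_cancel h0 h1]
  refine (ENNReal.mul_le_mul_iff_left h0 h1).1 ?_
  calc cellAvg P φ F m c ^ 2 * μ (P.cell m c) * μ (P.cell m c)
      = (cellAvg P φ F m c * μ (P.cell m c)) ^ 2 := by ring
    _ ≤ (∫⁻ y in P.cell m c, φ m c y ^ 2 ∂μ) * ∫⁻ x in P.cell m c, F x ^ 2 ∂μ := by rw [e]; exact h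
    _ ≤ (D * μ (P.cell m c)) * ∫⁻ x in P.cell m c, F x ^ 2 ∂μ := by
      gcongr; exact H.lintegral_sq_le m c
    _ = _ := by ring

include H hF hF2 in
lemma cellAvg_ne_top (m : ℕ) (c : ℤ) : cellAvg P φ F m c ≠ ∞ := by
  intro htop
  have h := H.cellAvg_sq_mul_measure_le hF m c
  rw [htop] at h
  have h' : (D : ℝ≥0∞) * ∫⁻ x in P.cell m c, F x ^ 2 ∂μ ≠ ∞ :=
    ENNReal.mul_ne_top ENNReal.coe_ne_top
      (ne_top_of_le_ne_top hF2 (setLIntegral_le_lintegral _ _))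
  refine h' (top_le_iff.1 (le_trans (le_of_eq ?_) h))
  simp [ENNReal.top_mul (P.measure_cell_ne_zero m c)]

-- Each of the two stopping criteria has threshold at least four times the corresponding average on
-- the cell, or a bound for it, so the weak type inequality confines each to a quarter of the cell.
include H hF hF2 in
lemma measure_laterStops_le (m j : ℕ) (c : ℤ)
    (hc : P.cell m c ⊆ stopSet (badCell P D Q φ v F) m) :
    2 * μ (P.cell m c ∩ laterStops (badCell P D Q φ v F) j (m + 1)) ≤ μ (P.cell m c) := by
  have hD : (D : ℝ≥0∞) ≠ 0 := by
    have := H.one_le_left; intro h; simp at h; simp [h] at this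
  have hQ : (Q : ℝ≥0∞) ≠ 0 := by
    have := H.one_le_right; intro h; simp at h; simp [h] at this
  set S₁ := {x | ∃ n, m ≤ n ∧ n < m + (j + 1) ∧
    (4 * D * Q : ℝ≥0∞) < ⨍⁻ y in P.cell n (P.idx n x), v m c y ∂μ}
  set S₂ := {x | ∃ n, m ≤ n ∧ n < m + (j + 1) ∧
    4 * cellAvg P φ F m c < ⨍⁻ y in P.cell n (P.idx n x), φ m c y * F y ∂μ}
  have h1 : 4 * μ (P.cell m c ∩ S₁) ≤ μ (P.cell m c) := by
    refine P.measure_maximal_le _ (j + 1) m c ?_ ?_ ?_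
    · simp [hD, hQ]
    · finiteness
    · rw [mul_assoc]; gcongr; exact H.laverage_le m c
  have h2 : 4 * μ (P.cell m c ∩ S₂) ≤ μ (P.cell m c) := by
    -- A zero threshold cannot be cancelled in the weak type bound, but then the integrand has zero
    -- integral on every subcell and the criterion never fires.
    by_cases ha : cellAvg P φ F m c = 0
    · have : P.cell m c ∩ S₂ = ∅ := by
        rw [Set.eq_empty_iff_forall_notMem]
        rintro x ⟨hx, n, hmn, -, hn⟩
        rw [cellAvg, setLAverage_eq, ENNReal.div_eq_zero_iff] at ha
        have ha' := ha.resolve_right (P.measure_cell_ne_top m c)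
        have hle : ∫⁻ y in P.cell n (P.idx n x), φ m c y * F y ∂μ ≤
            ∫⁻ y in P.cell m c, φ m c y * F y ∂μ := by
          refine lintegral_mono_set ?_
          have := P.cell_subset hmn x
          rwa [P.mem_cell.1 hx] at this
        rw [ha'] at hle
        rw [setLAverage_eq, le_zero_iff.1 hle] at hn
        simp at hn
      simp [this]
    · refine P.measure_maximal_le _ (j + 1) m c ?_ ?_ le_rfl
      · simp [ha]
      · exact ENNReal.mul_ne_top (by simp) (H.cellAvg_ne_top hF hF2 m c)
  have hsub : P.cell m c ∩ laterStops (badCell P D Q φ v F) j (m + 1) ⊆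
      (P.cell m c ∩ S₁) ∪ (P.cell m c ∩ S₂) := by
    rintro x ⟨hx, n, hn1, hn2, hn⟩
    obtain ⟨k, hk1, hk2, hk⟩ := exists_bad_of_mem_stopSet (by omega : m < n) (hc hx) hn
    rw [badCell, P.mem_cell.1 hx] at hk
    rcases hk with hk | hk
    · exact Or.inl ⟨hx, k, by omega, by omega, hk⟩
    · exact Or.inr ⟨hx, k, by omega, by omega, hk⟩
  have h3 := (measure_mono hsub).trans (measure_union_le (μ := μ) _ _)
  have h4 : 2 * (2 * μ (P.cell m c ∩ laterStops (badCell P D Q φ v F) j (m + 1))) ≤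
      2 * μ (P.cell m c) := by
    calc _ ≤ 2 * (2 * (μ (P.cell m c ∩ S₁) + μ (P.cell m c ∩ S₂))) := by gcongr
      _ = 4 * μ (P.cell m c ∩ S₁) + 4 * μ (P.cell m c ∩ S₂) := by ring
      _ ≤ μ (P.cell m c) + μ (P.cell m c) := add_le_add h1 h2
      _ = _ := by ring
  exact (ENNReal.mul_le_mul_iff_right (by simp) (by simp)).1 h4

-- The cell minus its later stops has at least half the measure, so by doubling it carries at least
-- a $1/(4Q)$ fraction of the mass of $\varphi^2$.
include H hF hF2 in
lemma setLIntegral_decay {t : ℝ≥0} (hrt : ∀ W B E : ℝ≥0, W = B + E → W ≤ 4 * Q * E →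
      W + t * (8 * Q * B) ≤ 8 * Q * W) {m₀ n : ℕ} {c₀ c : ℤ} (j : ℕ)
    (hs : P.cell n c ⊆ stopSet (badCell P D Q φ v F) n) (hc : P.cell n c ⊆ P.cell m₀ c₀) :
    (∫⁻ x in P.cell n c, φ m₀ c₀ x ^ 2 ∂μ) + t * ((8 * Q : ℝ≥0) *
        ∫⁻ x in P.cell n c ∩ laterStops (badCell P D Q φ v F) j (n + 1), φ m₀ c₀ x ^ 2 ∂μ) ≤
      (8 * Q : ℝ≥0) * ∫⁻ x in P.cell n c, φ m₀ c₀ x ^ 2 ∂μ := by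
  have hB := P.measurableSet_laterStops (badCell_congr (P := P) (D := D) (Q := Q) (φ := φ)
    (v := v) (F := F)) j (n + 1)
  set B := laterStops (badCell P D Q φ v F) j (n + 1)
  have hfin := H.setLIntegral_sq_ne_top hc
  have hm := H.measure_laterStops_le hF hF2 n j c hs
  have hIf := P.measure_cell_ne_top n c
  have hsplit := lintegral_inter_add_sdiff (μ := μ) (fun x => φ m₀ c₀ x ^ 2) (P.cell n c) hB
  have hmsplit := measure_inter_add_sdiff (μ := μ) (P.cell n c) hB
  have hhalf : μ (P.cell n c) ≤ 2 * μ (P.cell n c \ B) := by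
    have h1 : 2 * μ (P.cell n c) ≤ μ (P.cell n c) + 2 * μ (P.cell n c \ B) := by
      calc 2 * μ (P.cell n c) = 2 * μ (P.cell n c ∩ B) + 2 * μ (P.cell n c \ B) := by
            rw [← hmsplit]; ring
        _ ≤ _ := by gcongr
    rw [two_mul] at h1
    exact (ENNReal.add_le_add_iff_left hIf).1 h1
  have hd := H.doubling m₀ c₀ n c (P.cell n c \ B) ((P.measurableSet_cell n c).diff hB)
    Set.sdiff_subset hhalf
  have hBf : ∫⁻ x in P.cell n c ∩ B, φ m₀ c₀ x ^ 2 ∂μ ≠ ∞ :=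
    ne_top_of_le_ne_top hfin (lintegral_mono_set Set.inter_subset_left)
  have hEf : ∫⁻ x in P.cell n c \ B, φ m₀ c₀ x ^ 2 ∂μ ≠ ∞ :=
    ne_top_of_le_ne_top hfin (lintegral_mono_set Set.sdiff_subset)
  generalize ∫⁻ x in P.cell n c, φ m₀ c₀ x ^ 2 ∂μ = W at *
  generalize ∫⁻ x in P.cell n c ∩ B, φ m₀ c₀ x ^ 2 ∂μ = B' at *
  generalize ∫⁻ x in P.cell n c \ B, φ m₀ c₀ x ^ 2 ∂μ = E at *
  lift W to ℝ≥0 using hfin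
  lift B' to ℝ≥0 using hBf
  lift E to ℝ≥0 using hEf
  exact_mod_cast hrt W B' E (by exact_mod_cast hsplit.symm) (by exact_mod_cast hd)

end WeightFamily

end NestedPartition

end MatrixWeight

end

/-! ### The Carleson embedding and the abstract maximal theorem. -/

noncomputable section

namespace MatrixWeight

namespace NestedPartition

namespace WeightFamily

variable {α : Type*} [MeasurableSpace α] {μ : Measure α} {P : NestedPartition μ}
  {D Q : ℝ≥0} {φ v : ℕ → ℤ → α → ℝ≥0∞} {F : α → ℝ≥0∞}

/-- The sum of the squared averages over the stopping cells containing a point. -/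
def stopSum (P : NestedPartition μ) (D Q : ℝ≥0) (φ v : ℕ → ℤ → α → ℝ≥0∞) (F : α → ℝ≥0∞)
    (j m : ℕ) (x : α) : ℝ≥0∞ :=
  geomTail 1 (fun n => x ∈ stopSet (badCell P D Q φ v F) n)
    (fun n => cellAvg P φ F n (P.idx n x) ^ 2) j m

variable (H : P.WeightFamily D Q φ v) (hF : Measurable F) (hF2 : ∫⁻ x, F x ^ 2 ∂μ ≠ ∞)

lemma measurable_cellAvg (m : ℕ) : Measurable fun x => cellAvg P φ F m (P.idx m x) :=
  P.measurable_comp_idx m _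

lemma measurableSet_stop (m : ℕ) : MeasurableSet (stopSet (badCell P D Q φ v F) m) :=
  P.measurableSet_stopSet badCell_congr m

include H in
lemma measurable_apply_idx (m : ℕ) : Measurable fun x => φ m (P.idx m x) x :=
  P.measurable_idx_apply m (H.measurable m)

include H in
lemma measurable_cellAvg_mul (m : ℕ) :
    Measurable fun x => cellAvg P φ F m (P.idx m x) * φ m (P.idx m x) x :=
  (measurable_cellAvg m).mul (H.measurable_apply_idx m)

include H in
lemma measurable_cellAvg_mul_sq (m : ℕ) :
    Measurable fun x => (cellAvg P φ F m (P.idx m x) * φ m (P.idx m x) x) ^ 2 :=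
  (H.measurable_cellAvg_mul m).pow_const 2

open Classical in
lemma measurable_ite_stop (m : ℕ) {f : α → ℝ≥0∞} (hf : Measurable f) :
    Measurable fun x => if x ∈ stopSet (badCell P D Q φ v F) m then f x else 0 :=
  Measurable.ite (measurableSet_stop m) hf measurable_const

open Classical in
lemma lintegral_stopSum_succ (j m : ℕ) :
    ∫⁻ x, stopSum P D Q φ v F (j + 1) m x ∂μ =
      (∫⁻ x, (if x ∈ stopSet (badCell P D Q φ v F) m then
        cellAvg P φ F m (P.idx m x) ^ 2 else 0) ∂μ) + ∫⁻ x, stopSum P D Q φ v F j (m + 1) x ∂μ := by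
  simp only [stopSum, geomTail_one_succ]
  exact lintegral_add_left (Measurable.ite (measurableSet_stop m)
    ((measurable_cellAvg m).pow_const 2) measurable_const) _

lemma setLIntegral_cellAvg_sq (m : ℕ) (c : ℤ) :
    ∫⁻ x in P.cell m c, cellAvg P φ F m (P.idx m x) ^ 2 ∂μ =
      cellAvg P φ F m c ^ 2 * μ (P.cell m c) := by
  rw [← setLIntegral_const]
  refine setLIntegral_congr_fun (P.measurableSet_cell m c) fun x hx => ?_
  simp only [P.mem_cell.1 hx]

-- Each level costs at most $D\int F^2$ and there are finitely many; finiteness is what permits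
-- cancelling $X$ in the Carleson embedding.
include H hF hF2 in
lemma lintegral_stopSum_ne_top (j : ℕ) : ∀ m, ∫⁻ x, stopSum P D Q φ v F j m x ∂μ ≠ ∞ := by
  classical
  induction j with
  | zero => intro m; simp [stopSum, geomTail]
  | succ j ih =>
    intro m
    rw [lintegral_stopSum_succ]
    refine ENNReal.add_ne_top.2 ⟨?_, ih (m + 1)⟩
    have h : ∫⁻ x, (if x ∈ stopSet (badCell P D Q φ v F) m then
        cellAvg P φ F m (P.idx m x) ^ 2 else 0) ∂μ ≤ ∫⁻ x, D * F x ^ 2 ∂μ := by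
      refine P.lintegral_mono_of_cells m fun c => ?_
      calc _ ≤ ∫⁻ x in P.cell m c, cellAvg P φ F m (P.idx m x) ^ 2 ∂μ := by
            refine lintegral_mono fun x => ?_
            dsimp only
            split_ifs
            · exact le_rfl
            · exact zero_le
        _ ≤ D * ∫⁻ x in P.cell m c, F x ^ 2 ∂μ := by
            rw [setLIntegral_cellAvg_sq]; exact H.cellAvg_sq_mul_measure_le hF m c
        _ = _ := (lintegral_const_mul _ (hF.pow_const 2)).symm
    refine ne_top_of_le_ne_top ?_ h
    rw [lintegral_const_mul _ (hF.pow_const 2)]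
    exact ENNReal.mul_ne_top ENNReal.coe_ne_top hF2

-- The duality step: $a_I^2\mu(I)=a_I\int_I\varphi_IF$ for each stopping cell.
include H hF in
lemma lintegral_stopSum_le_lintegral_mul (j : ℕ) : ∀ m, ∫⁻ x, stopSum P D Q φ v F j m x ∂μ ≤
    ∫⁻ x, F x * geomTail 1 (fun n => x ∈ stopSet (badCell P D Q φ v F) n)
      (fun n => cellAvg P φ F n (P.idx n x) * φ n (P.idx n x) x) j m ∂μ := by
  classical
  induction j with
  | zero => intro m; simp [stopSum, geomTail]
  | succ j ih =>
    intro m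
    rw [lintegral_stopSum_succ]
    simp only [geomTail_one_succ, mul_add]
    have hm : Measurable fun x => F x * if x ∈ stopSet (badCell P D Q φ v F) m then
        cellAvg P φ F m (P.idx m x) * φ m (P.idx m x) x else 0 :=
      hF.mul (measurable_ite_stop m (H.measurable_cellAvg_mul m))
    rw [lintegral_add_left hm]
    refine add_le_add ?_ (ih (m + 1))
    simp only [mul_ite, mul_zero]
    refine P.lintegral_stopSet_mono badCell_congr m fun c _ => ?_
    rw [setLIntegral_cellAvg_sq, setLIntegral_congr_fun
      (g := fun x => cellAvg P φ F m c * (φ m c x * F x)) (P.measurableSet_cell m c)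
      (fun x hx => by simp only [P.mem_cell.1 hx]; ring),
      lintegral_const_mul _ (f := fun y => φ m c y * F y) ((H.measurable m c).mul hF), pow_two, mul_assoc]
    gcongr
    rw [cellAvg, setLAverage_eq, ENNReal.div_mul_cancel (P.measure_cell_ne_zero m c)
      (P.measure_cell_ne_top m c)]

include H in
lemma lintegral_geomTail_sq_le (j : ℕ) : ∀ m,
    ∫⁻ x, geomTail 1 (fun n => x ∈ stopSet (badCell P D Q φ v F) n)
      (fun n => (cellAvg P φ F n (P.idx n x) * φ n (P.idx n x) x) ^ 2) j m ∂μ ≤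
    D * ∫⁻ x, stopSum P D Q φ v F j m x ∂μ := by
  classical
  induction j with
  | zero => intro m; simp [geomTail]
  | succ j ih =>
    intro m
    rw [lintegral_stopSum_succ, mul_add]
    simp only [geomTail_one_succ]
    rw [lintegral_add_left (measurable_ite_stop m (H.measurable_cellAvg_mul_sq m))]
    refine add_le_add ?_ (ih (m + 1))
    rw [← lintegral_const_mul _ (measurable_ite_stop m ((measurable_cellAvg m).pow_const 2))]
    simp only [mul_ite, mul_zero]
    refine P.lintegral_stopSet_mono badCell_congr m fun c _ => ?_
    rw [lintegral_const_mul _ ((measurable_cellAvg m).pow_const 2), setLIntegral_cellAvg_sq,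
      setLIntegral_congr_fun
      (g := fun x => cellAvg P φ F m c ^ 2 * φ m c x ^ 2) (P.measurableSet_cell m c)
      (fun x hx => by simp only [P.mem_cell.1 hx]; ring),
      lintegral_const_mul _ ((H.measurable m c).pow_const 2)]
    calc cellAvg P φ F m c ^ 2 * ∫⁻ x in P.cell m c, φ m c x ^ 2 ∂μ
        ≤ cellAvg P φ F m c ^ 2 * (D * μ (P.cell m c)) := by
          gcongr; exact H.lintegral_sq_le m c
      _ = _ := by ring

-- The off-diagonal part of the Schur test: on a stopping cell, the growing weights $t^i$ are
-- absorbed by the decay of $\varphi_I^2$ at the cost of a factor $8Q$.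
include H hF hF2 in
lemma lintegral_schurTail_le {t : ℝ≥0} (hrt : ∀ W B E : ℝ≥0, W = B + E → W ≤ 4 * Q * E →
      W + t * (8 * Q * B) ≤ 8 * Q * W) (j : ℕ) : ∀ m,
    ∫⁻ x, schurTail t (fun n => x ∈ stopSet (badCell P D Q φ v F) n)
      (fun n => (cellAvg P φ F n (P.idx n x) * φ n (P.idx n x) x) ^ 2) j m ∂μ ≤
    (8 * Q : ℝ≥0) * (D * ∫⁻ x, stopSum P D Q φ v F j m x ∂μ) := by
  classical
  induction j with
  | zero => intro m; simp [schurTail]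
  | succ j ih =>
    intro m
    have hZ := measurable_geomTail (measurableSet_stop (P := P) (D := D) (Q := Q) (φ := φ)
      (v := v) (F := F)) t (b := fun _ _ => 1) (fun _ => measurable_const) (j + 1) m
    rw [lintegral_stopSum_succ, mul_add, mul_add]
    simp only [schurTail]
    have hbZ : Measurable fun x => (cellAvg P φ F m (P.idx m x) * φ m (P.idx m x) x) ^ 2 *
        geomTail t (fun n => x ∈ stopSet (badCell P D Q φ v F) n) (fun _ => 1) (j + 1) m :=
      (H.measurable_cellAvg_mul_sq m).mul hZ
    rw [lintegral_add_left (measurable_ite_stop m hbZ)]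
    refine add_le_add ?_ (ih (m + 1))
    have hm := measurable_ite_stop (P := P) (D := D) (Q := Q) (φ := φ) (v := v) (F := F) m
      ((measurable_cellAvg (P := P) (φ := φ) (F := F) m).pow_const 2)
    rw [← mul_assoc, ← lintegral_const_mul _ hm]
    simp only [mul_ite, mul_zero]
    refine P.lintegral_stopSet_mono badCell_congr m fun c hc => ?_
    rw [lintegral_const_mul _ ((measurable_cellAvg m).pow_const 2), setLIntegral_cellAvg_sq,
      setLIntegral_congr_fun
      (g := fun x => cellAvg P φ F m c ^ 2 * (φ m c x ^ 2 *
        geomTail t (fun n => x ∈ stopSet (badCell P D Q φ v F) n) (fun _ => 1) (j + 1) m))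
      (P.measurableSet_cell m c)
      (fun x hx => by simp only [P.mem_cell.1 hx]; ring),
      lintegral_const_mul _ (f := fun x => φ m c x ^ 2 *
        geomTail t (fun n => x ∈ stopSet (badCell P D Q φ v F) n) (fun _ => 1) (j + 1) m)
      (((H.measurable m c).pow_const 2).mul hZ)]
    have key := P.setLIntegral_mul_geomTail_le badCell_congr ((H.measurable m c).pow_const 2)
      (m₀ := m) (c₀ := c)
      (fun n c' i hs hc' => H.setLIntegral_decay hF hF2 hrt i hs hc') (j + 1) m c subset_rfl
    calc _ ≤ cellAvg P φ F m c ^ 2 * ∫⁻ x in P.cell m c, (8 * Q : ℝ≥0) * φ m c x ^ 2 ∂μ := by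
          gcongr cellAvg P φ F m c ^ 2 * ?_
          refine key.trans (lintegral_mono fun x => ?_)
          dsimp only
          gcongr
          exact Set.indicator_le_self _ _ x
      _ ≤ cellAvg P φ F m c ^ 2 * ((8 * Q : ℝ≥0) * (D * μ (P.cell m c))) := by
          rw [lintegral_const_mul _ ((H.measurable m c).pow_const 2)]
          gcongr; exact H.lintegral_sq_le m c
      _ = _ := by ring

include H hF hF2 in
/-- The Carleson embedding for the stopping cells. -/
lemma lintegral_stopSum_le (j : ℕ) :
    ∫⁻ x, stopSum P D Q φ v F j 0 x ∂μ ≤ 16 * Q * D * ∫⁻ x, F x ^ 2 ∂μ := by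
  obtain ⟨r, t, hrt, hr, hdecay⟩ := exists_schur_ratio H.one_le_right
  set X := ∫⁻ x, stopSum P D Q φ v F j 0 x ∂μ with hX
  have hXtop : X ≠ ∞ := H.lintegral_stopSum_ne_top hF hF2 j 0
  set g : α → ℝ≥0∞ := fun x => geomTail 1 (fun n => x ∈ stopSet (badCell P D Q φ v F) n)
      (fun n => cellAvg P φ F n (P.idx n x) * φ n (P.idx n x) x) j 0 with hg
  have hgm : Measurable g := measurable_geomTail measurableSet_stop 1
    (fun n => (measurable_cellAvg n).mul (H.measurable_apply_idx n)) j 0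
  have hsm : Measurable fun x => geomTail 1 (fun n => x ∈ stopSet (badCell P D Q φ v F) n)
      (fun n => (cellAvg P φ F n (P.idx n x) * φ n (P.idx n x) x) ^ 2) j 0 :=
    measurable_geomTail measurableSet_stop 1
    (fun n => ((measurable_cellAvg n).mul (H.measurable_apply_idx n)).pow_const 2) j 0
  have h1 : X ≤ ∫⁻ x, F x * g x ∂μ := H.lintegral_stopSum_le_lintegral_mul hF j 0
  -- The off-diagonal and diagonal sums contribute $8QDX$ each.
  have h2 : ∫⁻ x, g x ^ 2 ∂μ ≤ 16 * Q * D * X := by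
    calc ∫⁻ x, g x ^ 2 ∂μ ≤ ∫⁻ x, (schurTail t (fun n => x ∈ stopSet (badCell P D Q φ v F) n)
          (fun n => (cellAvg P φ F n (P.idx n x) * φ n (P.idx n x) x) ^ 2) j 0 +
          (8 * Q : ℝ≥0) * geomTail 1 (fun n => x ∈ stopSet (badCell P D Q φ v F) n)
          (fun n => (cellAvg P φ F n (P.idx n x) * φ n (P.idx n x) x) ^ 2) j 0) ∂μ := by
          refine lintegral_mono fun x => ?_
          refine le_trans le_self_add (geomTail_sq_le (r := r) (t := t) (L := (8 * Q : ℝ≥0))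
            (by exact_mod_cast hrt) (by exact_mod_cast hr) _ _ j 0)
      _ ≤ (8 * Q : ℝ≥0) * (D * X) + (8 * Q : ℝ≥0) * (D * X) := by
          rw [lintegral_add_right _ (hsm.const_mul _), lintegral_const_mul _ hsm]
          gcongr
          · exact H.lintegral_schurTail_le hF hF2 hdecay j 0
          · exact H.lintegral_geomTail_sq_le j 0
      _ = 16 * Q * D * X := by push_cast; ring
  -- Since $X^2\le\|F\|_2^2\|g\|_2^2$ and $\|g\|_2^2$ is controlled by $X$, one factor $X$ cancels.
  have h3 : X * X ≤ X * (16 * Q * D * ∫⁻ x, F x ^ 2 ∂μ) := by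
    calc X * X = X ^ 2 := (pow_two X).symm
      _ ≤ (∫⁻ x, F x * g x ∂μ) ^ 2 := by gcongr
      _ ≤ (∫⁻ x, F x ^ 2 ∂μ) * ∫⁻ x, g x ^ 2 ∂μ := 
        lintegral_mul_sq_le μ hF.aemeasurable hgm.aemeasurable
      _ ≤ (∫⁻ x, F x ^ 2 ∂μ) * (16 * Q * D * X) := by gcongr
      _ = _ := by ring
  by_cases h0 : X = 0
  · rw [h0]; exact zero_le
  · exact (ENNReal.mul_le_mul_iff_right h0 hXtop).1 h3

-- Compare with the last stop $p$. If the cell is not itself a stop, neither criterion holds: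
-- changing the normalization costs $4DQ$ in the square, and the average has grown at most fourfold,
-- giving $4DQ\cdot4^2$.
include H hF in
lemma cellAvg_sq_le_stopSum (x : α) {M n : ℕ} (hn : n < M) :
    cellAvg P φ F n (P.idx n x) ^ 2 ≤ 64 * D * Q * stopSum P D Q φ v F M 0 x := by
  have hcmp : ∀ m c n c', (⨍⁻ z in P.cell n c', v m c z ∂μ) ≤ 4 * D * Q →
      cellAvg P φ F n c' ^ 2 ≤
        4 * D * Q * (⨍⁻ y in P.cell n c', φ m c y * F y ∂μ) ^ 2 := by
    intro m c n c' hv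
    set s : ℝ≥0 := NNReal.sqrt (4 * D * Q) with hs
    have hs2 : (s : ℝ≥0∞) ^ 2 = 4 * D * Q := by
      have : s ^ 2 = 4 * D * Q := NNReal.sq_sqrt _
      exact_mod_cast this
    have hle : ∀ᵐ y ∂μ, φ n c' y ≤ s * φ m c y := by
      filter_upwards [H.compare m c n c'] with y hy
      refine (ENNReal.pow_le_pow_left_iff two_ne_zero).1 ?_
      rw [mul_pow, hs2]
      exact hy.trans (by gcongr)
    rw [← hs2, ← mul_pow]
    gcongr
    rw [cellAvg, setLAverage_eq, setLAverage_eq, ← mul_div_assoc]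
    gcongr
    rw [← lintegral_const_mul _ (f := fun y => φ m c y * F y) ((H.measurable m c).mul hF)]
    refine lintegral_mono_ae (ae_restrict_of_ae ?_)
    filter_upwards [hle] with y hy
    rw [← mul_assoc]
    gcongr
  set p := lastStop (badCell P D Q φ v F) n x with hp
  have hpn : p ≤ n := lastStop_le n x
  have h1 : cellAvg P φ F p (P.idx p x) ^ 2 ≤ stopSum P D Q φ v F M 0 x :=
    le_geomTail_one (u := fun n => x ∈ stopSet (badCell P D Q φ v F) n)
      (b := fun n => cellAvg P φ F n (P.idx n x) ^ 2) (n := p)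
      (mem_stopSet_lastStop n x) M 0 (Nat.zero_le _) (by omega)
  have hD : (1 : ℝ≥0∞) ≤ D := by exact_mod_cast H.one_le_left
  have hQ : (1 : ℝ≥0∞) ≤ Q := by exact_mod_cast H.one_le_right
  rcases lastStop_eq_or_not_bad (bad := badCell P D Q φ v F) n x with h | h
  · rw [← hp] at h
    rw [h] at h1
    refine h1.trans (le_mul_of_one_le_left zero_le ?_)
    calc (1 : ℝ≥0∞) = 1 * 1 * 1 := by norm_num
      _ ≤ 64 * D * Q := by gcongr; norm_num
  · rw [← hp, badCell, not_or, not_lt, not_lt] at h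
    calc _ ≤ 4 * D * Q * (⨍⁻ y in P.cell n (P.idx n x), φ p (P.idx p x) y * F y ∂μ) ^ 2 :=
          hcmp p (P.idx p x) n (P.idx n x) h.1
      _ ≤ 4 * D * Q * (4 * cellAvg P φ F p (P.idx p x)) ^ 2 := by gcongr; exact h.2
      _ = 64 * D * Q * cellAvg P φ F p (P.idx p x) ^ 2 := by ring
      _ ≤ _ := by gcongr

include H hF in
/-- The maximal function of a weight family is bounded on `L²`, linearly in `Q`. -/
theorem lintegral_iSup_cellAvg_sq_le (M : ℕ) :
    ∫⁻ x, ⨆ (n : ℕ) (_ : n < M), cellAvg P φ F n (P.idx n x) ^ 2 ∂μ ≤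
      (32 * D * Q) ^ 2 * ∫⁻ x, F x ^ 2 ∂μ := by
  by_cases hF2 : ∫⁻ x, F x ^ 2 ∂μ = ∞
  · have hD := H.one_le_left
    have hQ := H.one_le_right
    rw [hF2, ENNReal.mul_top]
    · exact le_top
    · have : (32 * D * Q) ^ 2 ≠ 0 := by positivity
      exact_mod_cast this
  have hm : Measurable (stopSum P D Q φ v F M 0) :=
    measurable_geomTail measurableSet_stop 1 (fun n => (measurable_cellAvg n).pow_const 2) M 0
  calc _ ≤ ∫⁻ x, 64 * D * Q * stopSum P D Q φ v F M 0 x ∂μ := by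
        exact lintegral_mono fun x => iSup₂_le fun n hn => H.cellAvg_sq_le_stopSum hF x hn
    _ = 64 * D * Q * ∫⁻ x, stopSum P D Q φ v F M 0 x ∂μ := lintegral_const_mul _ hm
    _ ≤ 64 * D * Q * (16 * Q * D * ∫⁻ x, F x ^ 2 ∂μ) := by
        gcongr; exact H.lintegral_stopSum_le hF hF2 M
    -- $64\cdot16=32^2$.
    _ = _ := by ring

end WeightFamily

end NestedPartition

end MatrixWeight

end

/-! ### Square roots, quadratic forms and the Hilbert–Schmidt norm. -/

noncomputable section

namespace MatrixWeight

open scoped ComplexOrder MatrixOrder Matrix.Norms.L2Operator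

variable {d : ℕ}

lemma act_eq_toEuclideanCLM (A : Matrix (Fin d) (Fin d) ℂ) (v : EuclideanSpace ℂ (Fin d)) :
    act A v = Matrix.toEuclideanCLM (𝕜 := ℂ) A v := rfl

lemma act_mul (A B : Matrix (Fin d) (Fin d) ℂ) (v : EuclideanSpace ℂ (Fin d)) :
    act (A * B) v = act A (act B v) := by
  simp [act]

@[simp] lemma act_one (v : EuclideanSpace ℂ (Fin d)) : act 1 v = v := by
  simp [act]

lemma inner_act_left (A : Matrix (Fin d) (Fin d) ℂ) (x y : EuclideanSpace ℂ (Fin d)) :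
    inner ℂ (act A x) y = inner ℂ x (act A.conjTranspose y) := by
  rw [act_eq_toEuclideanCLM, act_eq_toEuclideanCLM, ← Matrix.star_eq_conjTranspose, map_star,
    ContinuousLinearMap.star_eq_adjoint, ContinuousLinearMap.adjoint_inner_right]

lemma norm_act_le (A : Matrix (Fin d) (Fin d) ℂ) (v : EuclideanSpace ℂ (Fin d)) :
    ‖act A v‖ ≤ ‖A‖ * ‖v‖ :=
  ContinuousLinearMap.le_opNorm (Matrix.toEuclideanCLM (𝕜 := ℂ) A) v

/-- The quadratic form `v ↦ ⟪v, A v⟫`. -/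
def quadForm (A : Matrix (Fin d) (Fin d) ℂ) (v : EuclideanSpace ℂ (Fin d)) : ℝ :=
  (inner ℂ v (act A v)).re

lemma norm_act_sq (A : Matrix (Fin d) (Fin d) ℂ) (v : EuclideanSpace ℂ (Fin d)) :
    ‖act A v‖ ^ 2 = quadForm (A.conjTranspose * A) v := by
  rw [quadForm, act_mul, ← inner_act_left, inner_self_eq_norm_sq_to_K]
  norm_cast

lemma quadForm_eq_sum (A : Matrix (Fin d) (Fin d) ℂ) (v : EuclideanSpace ℂ (Fin d)) :
    quadForm A v = ∑ i, ∑ j, (A i j * (v j * star (v i))).re := by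
  simp only [quadForm, act, PiLp.inner_apply, Matrix.mulVec, dotProduct, RCLike.inner_apply,
    Complex.re_sum, Finset.sum_mul]
  refine Finset.sum_congr rfl fun i _ => Finset.sum_congr rfl fun j _ => ?_
  rw [mul_assoc]
  rfl

/-- The standard basis. -/
def stdVec (i : Fin d) : EuclideanSpace ℂ (Fin d) := EuclideanSpace.single i 1

lemma norm_stdVec (i : Fin d) : ‖stdVec i‖ = 1 := by simp [stdVec]

lemma act_stdVec_apply (A : Matrix (Fin d) (Fin d) ℂ) (i j : Fin d) :
    act A (stdVec i) j = A j i := by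
  simp [act, stdVec]

/-- The square of the Hilbert–Schmidt norm of a matrix. -/
def hsSq (A : Matrix (Fin d) (Fin d) ℂ) : ℝ := ∑ i, ‖act A (stdVec i)‖ ^ 2

lemma hsSq_nonneg (A : Matrix (Fin d) (Fin d) ℂ) : 0 ≤ hsSq A :=
  Finset.sum_nonneg fun _ _ => sq_nonneg _

lemma hsSq_eq_sum (A : Matrix (Fin d) (Fin d) ℂ) : hsSq A = ∑ i, ∑ j, ‖A j i‖ ^ 2 := by
  simp only [hsSq, EuclideanSpace.norm_sq_eq, act_stdVec_apply]

lemma hsSq_conjTranspose (A : Matrix (Fin d) (Fin d) ℂ) : hsSq A.conjTranspose = hsSq A := by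
  rw [hsSq_eq_sum, hsSq_eq_sum, Finset.sum_comm]
  simp

lemma norm_act_sq_le_hsSq (A : Matrix (Fin d) (Fin d) ℂ) (v : EuclideanSpace ℂ (Fin d)) :
    ‖act A v‖ ^ 2 ≤ hsSq A * ‖v‖ ^ 2 := by
  have hv : act A v = ∑ i, v i • act A (stdVec i) := by
    ext j
    have h : (∑ i, v i • act A (stdVec i)) j = ∑ i, v i * A j i := by
      simp [act_stdVec_apply]
    rw [h]
    simp [act, Matrix.mulVec, dotProduct, mul_comm]
  have h1 : ‖act A v‖ ≤ ∑ i, ‖act A (stdVec i)‖ * ‖v i‖ := by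
    rw [hv]
    refine (norm_sum_le _ _).trans (Finset.sum_le_sum fun i _ => ?_)
    rw [norm_smul, mul_comm]
  calc ‖act A v‖ ^ 2 ≤ (∑ i, ‖act A (stdVec i)‖ * ‖v i‖) ^ 2 := by gcongr
    _ ≤ (∑ i, ‖act A (stdVec i)‖ ^ 2) * ∑ i, ‖v i‖ ^ 2 := Finset.sum_mul_sq_le_sq_mul_sq _ _ _
    _ = _ := by rw [hsSq, EuclideanSpace.norm_sq_eq]

lemma hsSq_mul_le (A B : Matrix (Fin d) (Fin d) ℂ) : hsSq (A * B) ≤ hsSq A * hsSq B := by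
  change ∑ i, ‖act (A * B) (stdVec i)‖ ^ 2 ≤ hsSq A * ∑ i, ‖act B (stdVec i)‖ ^ 2
  rw [Finset.mul_sum]
  refine Finset.sum_le_sum fun i _ => ?_
  rw [act_mul]
  exact norm_act_sq_le_hsSq _ _

section Sqrt

variable {A : Matrix (Fin d) (Fin d) ℂ}

lemma sqrt_mul_sqrt (hA : A.PosDef) : CFC.sqrt A * CFC.sqrt A = A :=
  CFC.sqrt_mul_sqrt_self A hA.posSemidef.nonneg

lemma conjTranspose_sqrt (A : Matrix (Fin d) (Fin d) ℂ) :
    (CFC.sqrt A).conjTranspose = CFC.sqrt A :=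
  (Matrix.nonneg_iff_posSemidef.1 (CFC.sqrt_nonneg A)).isHermitian

lemma isUnit_det_sqrt (hA : A.PosDef) : IsUnit (CFC.sqrt A).det := by
  have h := (Matrix.isUnit_iff_isUnit_det A).1 hA.isUnit
  rw [← sqrt_mul_sqrt hA, Matrix.det_mul] at h
  exact isUnit_of_mul_isUnit_left h

lemma conjTranspose_sqrt_inv (A : Matrix (Fin d) (Fin d) ℂ) :
    ((CFC.sqrt A)⁻¹).conjTranspose = (CFC.sqrt A)⁻¹ := by
  rw [Matrix.conjTranspose_nonsing_inv, conjTranspose_sqrt]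

lemma sqrt_inv_mul_sqrt_inv (hA : A.PosDef) : (CFC.sqrt A)⁻¹ * (CFC.sqrt A)⁻¹ = A⁻¹ := by
  rw [← Matrix.mul_inv_rev, sqrt_mul_sqrt hA]

lemma sqrt_mul_sqrt_inv (hA : A.PosDef) : CFC.sqrt A * (CFC.sqrt A)⁻¹ = 1 :=
  Matrix.mul_nonsing_inv _ (isUnit_det_sqrt hA)

lemma sqrt_inv_mul_sqrt (hA : A.PosDef) : (CFC.sqrt A)⁻¹ * CFC.sqrt A = 1 :=
  Matrix.nonsing_inv_mul _ (isUnit_det_sqrt hA)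

lemma sqrt_inv_eq (hA : A.PosDef) : CFC.sqrt A⁻¹ = (CFC.sqrt A)⁻¹ := by
  refine CFC.sqrt_unique (sqrt_inv_mul_sqrt_inv hA) ?_
  exact ((Matrix.nonneg_iff_posSemidef.1 (CFC.sqrt_nonneg A)).inv).nonneg

lemma inv_sqrt_inv (hA : A.PosDef) : (CFC.sqrt A⁻¹)⁻¹ = CFC.sqrt A := by
  rw [sqrt_inv_eq hA, Matrix.nonsing_inv_nonsing_inv _ (isUnit_det_sqrt hA)]

lemma norm_act_sqrt_sq (hA : A.PosDef) (v : EuclideanSpace ℂ (Fin d)) :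
    ‖act (CFC.sqrt A) v‖ ^ 2 = quadForm A v := by
  rw [norm_act_sq, conjTranspose_sqrt, sqrt_mul_sqrt hA]

lemma norm_act_sqrt_inv_sq (hA : A.PosDef) (v : EuclideanSpace ℂ (Fin d)) :
    ‖act (CFC.sqrt A)⁻¹ v‖ ^ 2 = quadForm A⁻¹ v := by
  rw [norm_act_sq, conjTranspose_sqrt_inv, sqrt_inv_mul_sqrt_inv hA]

lemma quadForm_nonneg (hA : A.PosDef) (v : EuclideanSpace ℂ (Fin d)) : 0 ≤ quadForm A v := by
  rw [← norm_act_sqrt_sq hA]; positivity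

/-- $\langle e,u\rangle=\langle A^{1/2}e,A^{-1/2}u\rangle$, then Cauchy–Schwarz. -/
lemma norm_inner_sq_le (hA : A.PosDef) (e u : EuclideanSpace ℂ (Fin d)) :
    ‖inner ℂ e u‖ ^ 2 ≤ quadForm A e * quadForm A⁻¹ u := by
  rw [← norm_act_sqrt_sq hA, ← norm_act_sqrt_inv_sq hA, ← mul_pow]
  gcongr
  have : inner ℂ e u = inner ℂ (act (CFC.sqrt A) e) (act (CFC.sqrt A)⁻¹ u) := by
    rw [inner_act_left, conjTranspose_sqrt, ← act_mul, sqrt_mul_sqrt_inv hA, act_one]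
  rw [this]
  exact norm_inner_le_norm _ _

lemma quadForm_pos (hA : A.PosDef) {v : EuclideanSpace ℂ (Fin d)} (hv : v ≠ 0) :
    0 < quadForm A v := by
  refine lt_of_le_of_ne (quadForm_nonneg hA v) fun h => hv ?_
  have h1 := norm_inner_sq_le hA v v
  rw [← h, zero_mul] at h1
  have h2 : ‖inner ℂ v v‖ = 0 := by nlinarith [norm_nonneg (inner ℂ v v)]
  exact inner_self_eq_zero.1 (norm_eq_zero.1 h2)

lemma hsSq_sqrt_mul (hA : A.PosDef) (M : Matrix (Fin d) (Fin d) ℂ) :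
    hsSq (CFC.sqrt A * M) = ∑ i, quadForm A (act M (stdVec i)) := by
  simp only [hsSq, act_mul, norm_act_sqrt_sq hA]

lemma hsSq_le_norm_sq (M : Matrix (Fin d) (Fin d) ℂ) : hsSq M ≤ d * ‖M‖ ^ 2 := by
  calc hsSq M ≤ ∑ _i : Fin d, ‖M‖ ^ 2 := by
        refine Finset.sum_le_sum fun i _ => ?_
        gcongr
        simpa [norm_stdVec] using norm_act_le M (stdVec i)
    _ = _ := by simp

end Sqrt

end MatrixWeight

end

/-! ### Averages of matrix weights. -/

noncomputable section

namespace MatrixWeight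

open scoped ComplexOrder MatrixOrder Matrix.Norms.L2Operator

variable {d : ℕ}

lemma posDef_of_quadForm_pos {A : Matrix (Fin d) (Fin d) ℂ} (hA : A.IsHermitian)
    (h : ∀ v : EuclideanSpace ℂ (Fin d), v ≠ 0 → 0 < quadForm A v) : A.PosDef := by
  refine Matrix.PosDef.of_dotProduct_mulVec_pos hA fun x hx => ?_
  have e : inner ℂ (WithLp.toLp 2 x) (act A (WithLp.toLp 2 x)) = star x ⬝ᵥ (A.mulVec x) := by
    rw [EuclideanSpace.inner_eq_star_dotProduct, dotProduct_comm]
    rfl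
  rw [Complex.pos_iff]
  constructor
  · have := h (WithLp.toLp 2 x) (by simpa using hx)
    rwa [quadForm, e] at this
  · exact (hA.im_star_dotProduct_mulVec_self x).symm

namespace IsMatrixWeight

variable {V : ℝ → Matrix (Fin d) (Fin d) ℂ} (hV : IsMatrixWeight V)

include hV

lemma integrableOn_apply (i j : Fin d) (a b : ℝ) :
    IntegrableOn (fun x => V x i j) (Set.Ico a b) :=
  ((hV.locallyIntegrable i j).integrableOn_isCompact isCompact_Icc).mono_set
    Set.Ico_subset_Icc_self

lemma integrableOn_term (i j : Fin d) (z : ℂ) (a b : ℝ) :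
    IntegrableOn (fun x => (V x i j * z).re) (Set.Ico a b) :=
  ((hV.integrableOn_apply i j a b).mul_const z).re

lemma integrableOn_quadForm (v : EuclideanSpace ℂ (Fin d)) (a b : ℝ) :
    IntegrableOn (fun x => quadForm (V x) v) (Set.Ico a b) := by
  simp only [quadForm_eq_sum]
  exact integrable_finsetSum _ fun i _ => integrable_finsetSum _ fun j _ =>
    hV.integrableOn_term i j _ a b

lemma quadForm_matAvg (v : EuclideanSpace ℂ (Fin d)) (a b : ℝ) :
    quadForm (matAvg V (Set.Ico a b)) v = ⨍ x in Set.Ico a b, quadForm (V x) v := by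
  rw [setAverage_eq]
  simp only [quadForm_eq_sum]
  rw [integral_finsetSum _ fun i _ => integrable_finsetSum _ fun j _ =>
    hV.integrableOn_term i j _ a b, Finset.smul_sum]
  refine Finset.sum_congr rfl fun i _ => ?_
  rw [integral_finsetSum _ fun j _ => hV.integrableOn_term i j _ a b, Finset.smul_sum]
  refine Finset.sum_congr rfl fun j _ => ?_
  have h := (hV.integrableOn_apply i j a b).mul_const (v j * star (v i))
  have h1 := integral_re (𝕜 := ℂ) h
  simp only [RCLike.re_to_complex] at h1
  rw [h1, integral_mul_const, matAvg, Matrix.of_apply, setAverage_eq, smul_mul_assoc,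
    Complex.smul_re]

lemma isHermitian_matAvg (a b : ℝ) : (matAvg V (Set.Ico a b)).IsHermitian := by
  ext i j
  rw [Matrix.conjTranspose_apply, matAvg, Matrix.of_apply, Matrix.of_apply, setAverage_eq,
    setAverage_eq, star_smul, star_trivial]
  congr 1
  have h := integral_conj (𝕜 := ℂ) (f := fun x => V x j i) (μ := volume.restrict (Set.Ico a b))
  refine h.symm.trans (integral_congr_ae (ae_restrict_of_ae ?_))
  filter_upwards [hV.posDef] with x hx
  exact hx.isHermitian.apply i j

lemma posDef_matAvg {a b : ℝ} (hab : a < b) : (matAvg V (Set.Ico a b)).PosDef := by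
  refine posDef_of_quadForm_pos (hV.isHermitian_matAvg a b) fun v hv => ?_
  rw [hV.quadForm_matAvg, setAverage_eq]
  have hpos : ∀ᵐ x ∂(volume : Measure ℝ), 0 < quadForm (V x) v := by
    filter_upwards [hV.posDef] with x hx using quadForm_pos hx hv
  have hvol : 0 < volume.real (Set.Ico a b) := by
    rw [Measure.real, Real.volume_Ico, ENNReal.toReal_ofReal (by linarith)]
    linarith
  refine smul_pos (inv_pos.2 hvol) ?_
  rw [setIntegral_pos_iff_support_of_nonneg_ae
    (ae_restrict_of_ae (hpos.mono fun x hx => hx.le)) (hV.integrableOn_quadForm v a b)]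
  have : volume (Set.Ico a b) ≤
      volume ((Function.support fun x => quadForm (V x) v) ∩ Set.Ico a b) := by
    refine measure_mono_ae ?_
    filter_upwards [hpos] with x hx hx'
    exact ⟨hx.ne', hx'⟩
  refine lt_of_lt_of_le ?_ this
  simpa using hab

lemma lintegral_quadForm {a b : ℝ} (hab : a < b) (v : EuclideanSpace ℂ (Fin d)) :
    ∫⁻ x in Set.Ico a b, ENNReal.ofReal (quadForm (V x) v) =
      ENNReal.ofReal (quadForm (matAvg V (Set.Ico a b)) v) * volume (Set.Ico a b) := by
  have hnn : 0 ≤ᵐ[volume.restrict (Set.Ico a b)] fun x => quadForm (V x) v :=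
    ae_restrict_of_ae (hV.posDef.mono fun x hx => quadForm_nonneg hx v)
  rw [← ofReal_integral_eq_lintegral_ofReal (hV.integrableOn_quadForm v a b) hnn,
    hV.quadForm_matAvg, setAverage_eq, Real.volume_Ico, ← ENNReal.ofReal_mul' (by linarith)]
  congr 1
  have : b - a ≠ 0 := by linarith
  simp only [Measure.real, Real.volume_Ico, smul_eq_mul]
  rw [ENNReal.toReal_ofReal (by linarith)]
  field_simp

lemma aemeasurable_quadForm (v : EuclideanSpace ℂ (Fin d)) :
    AEMeasurable (fun x => quadForm (V x) v) := by
  simp only [quadForm_eq_sum]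
  refine Finset.aemeasurable_fun_sum _ fun i _ => Finset.aemeasurable_fun_sum _ fun j _ => ?_
  have h := (hV.locallyIntegrable i j).aestronglyMeasurable.aemeasurable
  exact Complex.measurable_re.comp_aemeasurable (h.mul_const _)

lemma aemeasurable_ofReal_quadForm (v : EuclideanSpace ℂ (Fin d)) :
    AEMeasurable fun x => ENNReal.ofReal (quadForm (V x) v) :=
  ENNReal.measurable_ofReal.comp_aemeasurable (hV.aemeasurable_quadForm v)

/-- Integrate the pointwise matrix Cauchy–Schwarz inequality over $E$, then apply it again to the
integral. Both $\langle V\rangle^{-1}\le\langle V^{-1}\rangle$ and doubling come from this. -/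
lemma measure_mul_inner_sq_le (hV' : IsMatrixWeight fun x => (V x)⁻¹)
    (E : Set ℝ) (e u : EuclideanSpace ℂ (Fin d)) :
    (volume E * ‖inner ℂ e u‖ₑ) ^ 2 ≤
      (∫⁻ x in E, ENNReal.ofReal (quadForm (V x) e)) *
        ∫⁻ x in E, ENNReal.ofReal (quadForm (V x)⁻¹ u) := by
  have hm : ∀ {f : ℝ → ℝ}, AEMeasurable f → AEMeasurable
      (fun x => ENNReal.ofReal (Real.sqrt (f x))) (volume.restrict E) := fun hf =>
    (ENNReal.measurable_ofReal.comp_aemeasurable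
      (Real.continuous_sqrt.measurable.comp_aemeasurable hf)).restrict
  have h := lintegral_mul_sq_le (volume.restrict E) (hm (hV.aemeasurable_quadForm e))
    (hm (hV'.aemeasurable_quadForm u))
  have hsq : ∀ z : ℝ, ENNReal.ofReal (Real.sqrt z) ^ 2 = ENNReal.ofReal z := fun z => by
    rcases le_total 0 z with hz | hz
    · rw [← ENNReal.ofReal_pow (Real.sqrt_nonneg z), Real.sq_sqrt hz]
    · rw [Real.sqrt_eq_zero_of_nonpos hz, ENNReal.ofReal_of_nonpos hz]; simp
  simp only [hsq] at h
  refine le_trans ?_ h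
  gcongr
  rw [mul_comm, ← setLIntegral_const]
  refine lintegral_mono_ae (ae_restrict_of_ae ?_)
  filter_upwards [hV.posDef] with x hx
  rw [← ofReal_norm, ← ENNReal.ofReal_mul (Real.sqrt_nonneg _), ← Real.sqrt_mul
    (quadForm_nonneg hx e)]
  exact ENNReal.ofReal_le_ofReal (Real.le_sqrt_of_sq_le (norm_inner_sq_le hx e u))

/-- The averages of a weight and of its inverse satisfy `⟨V⟩⁻¹ ≤ ⟨V⁻¹⟩`. -/
lemma norm_act_sqrt_matAvg_inv_le (hV' : IsMatrixWeight fun x => (V x)⁻¹) {a b : ℝ}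
    (hab : a < b) (u : EuclideanSpace ℂ (Fin d)) :
    ‖act (CFC.sqrt (matAvg V (Set.Ico a b)))⁻¹ u‖ ≤
      ‖act (CFC.sqrt (matAvg (fun x => (V x)⁻¹) (Set.Ico a b))) u‖ := by
  have hA := hV.posDef_matAvg hab
  have hB := hV'.posDef_matAvg hab
  set A := matAvg V (Set.Ico a b)
  set B := matAvg (fun x => (V x)⁻¹) (Set.Ico a b)
  have hvol0 : volume (Set.Ico a b) ≠ 0 := by simpa using hab
  have hvol : volume (Set.Ico a b) ≠ ∞ := by simp
  -- For the test vector $A^{-1}u$, both the inner product with $u$ and the $A$-energy equal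
  -- $\|A^{-1/2}u\|^2$.
  have h := hV.measure_mul_inner_sq_le hV' (Set.Ico a b) (act A⁻¹ u) u
  rw [hV.lintegral_quadForm hab, hV'.lintegral_quadForm hab] at h
  change _ ≤ ENNReal.ofReal (quadForm A _) * _ * (ENNReal.ofReal (quadForm B u) * _) at h
  have hS : act A⁻¹ u = act (CFC.sqrt A)⁻¹ (act (CFC.sqrt A)⁻¹ u) := by
    rw [← act_mul, sqrt_inv_mul_sqrt_inv hA]
  have h1 : inner ℂ (act A⁻¹ u) u = ((‖act (CFC.sqrt A)⁻¹ u‖ ^ 2 : ℝ) : ℂ) := by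
    rw [hS, inner_act_left, conjTranspose_sqrt_inv, inner_self_eq_norm_sq_to_K]
    norm_cast
  have h2 : quadForm A (act A⁻¹ u) = ‖act (CFC.sqrt A)⁻¹ u‖ ^ 2 := by
    rw [← norm_act_sqrt_sq hA, hS, ← act_mul, sqrt_mul_sqrt_inv hA, act_one]
  rw [h1, h2, ← norm_act_sqrt_sq hB, ← ofReal_norm] at h
  simp only [Complex.norm_real, norm_pow, norm_norm] at h
  set s := ‖act (CFC.sqrt A)⁻¹ u‖ with hs
  set r := ‖act (CFC.sqrt B) u‖ with hr
  have h3 : volume (Set.Ico a b) ^ 2 * ENNReal.ofReal (s ^ 2) ^ 2 ≤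
      volume (Set.Ico a b) ^ 2 * (ENNReal.ofReal (s ^ 2) * ENNReal.ofReal (r ^ 2)) := by
    calc _ = (volume (Set.Ico a b) * ENNReal.ofReal (s ^ 2)) ^ 2 := by ring
      _ ≤ _ := h
      _ = _ := by ring
  have h4 := (ENNReal.mul_le_mul_iff_right (pow_ne_zero 2 hvol0) (ENNReal.pow_ne_top hvol)).1 h3
  have hs0 : 0 ≤ s := norm_nonneg _
  have hr0 : 0 ≤ r := norm_nonneg _
  rw [← ENNReal.ofReal_pow (by positivity), ← ENNReal.ofReal_mul (by positivity),
    ENNReal.ofReal_le_ofReal_iff (by positivity)] at h4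
  by_contra! hlt
  have h5 : 0 < s := hr0.trans_lt hlt
  have h6 : r ^ 2 < s ^ 2 := by gcongr
  have h7 : s ^ 2 * r ^ 2 < s ^ 2 * s ^ 2 := by gcongr
  nlinarith

end IsMatrixWeight

end MatrixWeight

end

/-! ### Normalized and dual traces: comparison and doubling. -/

noncomputable section

namespace MatrixWeight

open scoped ComplexOrder MatrixOrder Matrix.Norms.L2Operator

variable {d : ℕ}

/-- The square of the Hilbert–Schmidt norm of `⟨V⟩_I ^ (-1/2) * V ^ (1/2)`. -/
def normalizedTrace (V : ℝ → Matrix (Fin d) (Fin d) ℂ) (I : Set ℝ) (y : ℝ) : ℝ≥0∞ :=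
  ∑ i, ENNReal.ofReal (quadForm (V y) (act (CFC.sqrt (matAvg V I))⁻¹ (stdVec i)))

/-- The square of the Hilbert–Schmidt norm of `⟨V⟩_I ^ (1/2) * V ^ (-1/2)`. -/
def dualTrace (V : ℝ → Matrix (Fin d) (Fin d) ℂ) (I : Set ℝ) (y : ℝ) : ℝ≥0∞ :=
  ∑ i, ENNReal.ofReal (quadForm (V y)⁻¹ (act (CFC.sqrt (matAvg V I)) (stdVec i)))

lemma norm_sqrt_mul_sqrt_comm (A B : Matrix (Fin d) (Fin d) ℂ) :
    ‖CFC.sqrt B * CFC.sqrt A‖ = ‖CFC.sqrt A * CFC.sqrt B‖ := by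
  rw [← Matrix.l2_opNorm_conjTranspose, Matrix.conjTranspose_mul, conjTranspose_sqrt,
    conjTranspose_sqrt]

namespace IsMatrixWeight

lemma lintegral_dualTrace {V : ℝ → Matrix (Fin d) (Fin d) ℂ}
    (hV' : IsMatrixWeight fun x => (V x)⁻¹) {a b : ℝ} (hab : a < b) (I : Set ℝ) :
    ∫⁻ y in Set.Ico a b, dualTrace V I y =
      ENNReal.ofReal (hsSq (CFC.sqrt (matAvg (fun x => (V x)⁻¹) (Set.Ico a b)) *
        CFC.sqrt (matAvg V I))) * volume (Set.Ico a b) := by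
  simp only [dualTrace]
  rw [lintegral_finsetSum' _ fun i _ => (hV'.aemeasurable_ofReal_quadForm _).restrict]
  have hB := hV'.posDef_matAvg hab
  rw [hsSq_sqrt_mul hB, ENNReal.ofReal_sum_of_nonneg fun i _ => quadForm_nonneg hB _,
    Finset.sum_mul]
  exact Finset.sum_congr rfl fun i _ => hV'.lintegral_quadForm hab _

lemma laverage_dualTrace {V : ℝ → Matrix (Fin d) (Fin d) ℂ}
    (hV' : IsMatrixWeight fun x => (V x)⁻¹) {a b : ℝ} (hab : a < b) (I : Set ℝ) :
    ⨍⁻ y in Set.Ico a b, dualTrace V I y ∂volume =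
      ENNReal.ofReal (hsSq (CFC.sqrt (matAvg (fun x => (V x)⁻¹) (Set.Ico a b)) *
        CFC.sqrt (matAvg V I))) := by
  rw [setLAverage_eq, hV'.lintegral_dualTrace hab, ENNReal.mul_div_cancel_right]
  · simpa using hab
  · simp

lemma laverage_dualTrace_self_le {V : ℝ → Matrix (Fin d) (Fin d) ℂ}
    (hV' : IsMatrixWeight fun x => (V x)⁻¹) {Q : ℝ≥0} {a b : ℝ} (hab : a < b)
    (hQ : ‖CFC.sqrt (matAvg V (Set.Ico a b)) *
      CFC.sqrt (matAvg (fun x => (V x)⁻¹) (Set.Ico a b))‖ₑ ^ 2 ≤ Q) :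
    ⨍⁻ y in Set.Ico a b, dualTrace V (Set.Ico a b) y ∂volume ≤ d * Q := by
  rw [hV'.laverage_dualTrace hab]
  refine (ENNReal.ofReal_le_ofReal (hsSq_le_norm_sq _)).trans ?_
  rw [norm_sqrt_mul_sqrt_comm, ENNReal.ofReal_mul (by positivity), ENNReal.ofReal_natCast,
    ENNReal.ofReal_pow (norm_nonneg _), ofReal_norm]
  gcongr

variable {V : ℝ → Matrix (Fin d) (Fin d) ℂ} (hV : IsMatrixWeight V)

include hV

lemma aemeasurable_normalizedTrace (I : Set ℝ) : AEMeasurable (normalizedTrace V I) :=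
  Finset.aemeasurable_fun_sum _ fun _ _ => hV.aemeasurable_ofReal_quadForm _

/-- The Hilbert–Schmidt norm is invariant under adjoints, so its square is a sum of quadratic forms
of $V(y)$ at vectors independent of $y$, which integrates linearly. -/
lemma normalizedTrace_eq {I : Set ℝ} : ∀ᵐ y ∂(volume : Measure ℝ),
    normalizedTrace V I y =
      ENNReal.ofReal (hsSq ((CFC.sqrt (matAvg V I))⁻¹ * CFC.sqrt (V y))) := by
  filter_upwards [hV.posDef] with y hy
  rw [← hsSq_conjTranspose, Matrix.conjTranspose_mul, conjTranspose_sqrt, conjTranspose_sqrt_inv,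
    hsSq_sqrt_mul hy, normalizedTrace, ENNReal.ofReal_sum_of_nonneg]
  exact fun i _ => quadForm_nonneg hy _

/-- Each vector $\langle V\rangle_I^{-1/2}e_i$ has unit energy for $\langle V\rangle_I$, and there
are $d$ of them. -/
lemma lintegral_normalizedTrace {a b : ℝ} (hab : a < b) :
    ∫⁻ y in Set.Ico a b, normalizedTrace V (Set.Ico a b) y = d * volume (Set.Ico a b) := by
  simp only [normalizedTrace]
  rw [lintegral_finsetSum' _ fun i _ => (hV.aemeasurable_ofReal_quadForm _).restrict]
  have hA := hV.posDef_matAvg hab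
  have : ∀ i : Fin d, ∫⁻ y in Set.Ico a b, ENNReal.ofReal (quadForm (V y)
      (act (CFC.sqrt (matAvg V (Set.Ico a b)))⁻¹ (stdVec i))) = volume (Set.Ico a b) := by
    intro i
    rw [hV.lintegral_quadForm hab, ← norm_act_sqrt_sq hA, ← act_mul, sqrt_mul_sqrt_inv hA,
      act_one, norm_stdVec]
    simp
  simp [this]

lemma enorm_act_le_normalizedTrace (I : Set ℝ) : ∀ᵐ y ∂(volume : Measure ℝ),
    ∀ z : EuclideanSpace ℂ (Fin d), ‖act ((CFC.sqrt (matAvg V I))⁻¹ * CFC.sqrt (V y)) z‖ₑ ≤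
      normalizedTrace V I y ^ (1 / 2 : ℝ) * ‖z‖ₑ := by
  filter_upwards [hV.normalizedTrace_eq (I := I)] with y hy z
  rw [hy, ENNReal.ofReal_rpow_of_nonneg (hsSq_nonneg _) (by norm_num), ← Real.sqrt_eq_rpow,
    ← ofReal_norm, ← ofReal_norm, ← ENNReal.ofReal_mul (Real.sqrt_nonneg _)]
  refine ENNReal.ofReal_le_ofReal ?_
  refine abs_le_of_sq_le_sq' ?_ (by positivity) |>.2
  rw [mul_pow, Real.sq_sqrt (hsSq_nonneg _)]
  exact norm_act_sq_le_hsSq _ _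

variable (hV' : IsMatrixWeight fun x => (V x)⁻¹)

include hV'

/-- Passing from one interval to another in the normalization of a weight costs the average of
the dual trace. -/
lemma normalizedTrace_le {a b : ℝ} (hab : a < b) {a' b' : ℝ} (hab' : a' < b') :
    ∀ᵐ y ∂(volume : Measure ℝ), normalizedTrace V (Set.Ico a' b') y ≤
      (⨍⁻ z in Set.Ico a' b', dualTrace V (Set.Ico a b) z ∂volume) *
        normalizedTrace V (Set.Ico a b) y := by
  filter_upwards [hV.normalizedTrace_eq (I := Set.Ico a b),
    hV.normalizedTrace_eq (I := Set.Ico a' b')] with y hy hy'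
  rw [hy, hy', hV'.laverage_dualTrace hab', ← ENNReal.ofReal_mul (hsSq_nonneg _)]
  refine ENNReal.ofReal_le_ofReal ?_
  have hA := hV.posDef_matAvg hab
  set B := matAvg (fun x => (V x)⁻¹) (Set.Ico a' b')
  set A := matAvg V (Set.Ico a b)
  -- Replace $\langle V\rangle^{-1}$ on the new interval by $\langle V^{-1}\rangle$, then insert
  -- $A^{1/2}A^{-1/2}$; the first factor is the average of the dual trace.
  calc hsSq ((CFC.sqrt (matAvg V (Set.Ico a' b')))⁻¹ * CFC.sqrt (V y))
      ≤ hsSq (CFC.sqrt B * CFC.sqrt (V y)) := by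
        refine Finset.sum_le_sum fun i _ => ?_
        rw [act_mul, act_mul]
        gcongr
        exact hV.norm_act_sqrt_matAvg_inv_le hV' hab' _
    _ = hsSq ((CFC.sqrt B * CFC.sqrt A) * ((CFC.sqrt A)⁻¹ * CFC.sqrt (V y))) := by
        rw [Matrix.mul_assoc, ← Matrix.mul_assoc (CFC.sqrt A), sqrt_mul_sqrt_inv hA,
          Matrix.one_mul]
    _ ≤ _ := hsSq_mul_le _ _

lemma one_le_norm_sqrt_mul_sqrt [NeZero d] {a b : ℝ} (hab : a < b) :
    1 ≤ ‖CFC.sqrt (matAvg V (Set.Ico a b)) *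
      CFC.sqrt (matAvg (fun x => (V x)⁻¹) (Set.Ico a b))‖ := by
  have hA := hV.posDef_matAvg hab
  have h := hV.norm_act_sqrt_matAvg_inv_le hV' hab
    (act (CFC.sqrt (matAvg V (Set.Ico a b))) (stdVec 0))
  rw [← act_mul, ← act_mul, sqrt_inv_mul_sqrt hA, act_one, norm_stdVec] at h
  refine h.trans ((norm_act_le _ _).trans_eq ?_)
  rw [norm_stdVec, mul_one, norm_sqrt_mul_sqrt_comm]

variable {Q : ℝ≥0} {a b : ℝ} (hab : a < b) (hQ : ‖CFC.sqrt (matAvg V (Set.Ico a b)) *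
  CFC.sqrt (matAvg (fun x => (V x)⁻¹) (Set.Ico a b))‖ₑ ^ 2 ≤ Q)

include hab hQ

/-- The weights `⟨V e, e⟩` are uniformly doubling. -/
lemma lintegral_quadForm_le_of_subset {E : Set ℝ} (hE : E ⊆ Set.Ico a b)
    (hvol : volume (Set.Ico a b) ≤ 2 * volume E) (e : EuclideanSpace ℂ (Fin d)) :
    ∫⁻ y in Set.Ico a b, ENNReal.ofReal (quadForm (V y) e) ≤
      4 * Q * ∫⁻ y in E, ENNReal.ofReal (quadForm (V y) e) := by
  have hA := hV.posDef_matAvg hab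
  have hB := hV'.posDef_matAvg hab
  rw [hV.lintegral_quadForm hab]
  set A := matAvg V (Set.Ico a b)
  -- With $u=Ae$ the inner product is the energy $q$, while the $A_2$ condition bounds the
  -- $V^{-1}$-energy of $u$ over the interval by $Qq|I|$.
  have h := hV.measure_mul_inner_sq_le hV' E e (act A e)
  set X := ∫⁻ y in E, ENNReal.ofReal (quadForm (V y) e)
  set q := ENNReal.ofReal (quadForm A e) with hq
  have h1 : q ≤ ‖inner ℂ e (act A e)‖ₑ := by
    rw [← ofReal_norm]
    exact ENNReal.ofReal_le_ofReal (Complex.re_le_norm _)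
  have h2 : ∫⁻ x in E, ENNReal.ofReal (quadForm (V x)⁻¹ (act A e)) ≤
      Q * q * volume (Set.Ico a b) := by
    refine (lintegral_mono_set hE).trans ?_
    rw [hV'.lintegral_quadForm hab]
    gcongr
    set B := matAvg (fun x => (V x)⁻¹) (Set.Ico a b)
    have h3 : quadForm B (act A e) ≤ ‖CFC.sqrt A * CFC.sqrt B‖ ^ 2 * quadForm A e := by
      have h4 : act (CFC.sqrt B) (act A e) =
          act (CFC.sqrt B * CFC.sqrt A) (act (CFC.sqrt A) e) := by
        rw [← act_mul, ← act_mul, Matrix.mul_assoc, sqrt_mul_sqrt hA]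
      rw [← norm_act_sqrt_sq hB, h4, ← norm_act_sqrt_sq hA, ← norm_sqrt_mul_sqrt_comm A B,
        ← mul_pow]
      gcongr
      exact norm_act_le _ _
    refine (ENNReal.ofReal_le_ofReal h3).trans ?_
    rw [ENNReal.ofReal_mul (by positivity), ENNReal.ofReal_pow (norm_nonneg _), ofReal_norm]
    gcongr
  set v := volume (Set.Ico a b)
  have hvtop : v ≠ ∞ := by simp [v]
  have hqtop : q ≠ ∞ := ENNReal.ofReal_ne_top
  by_cases h0 : q * v = 0
  · rw [h0]; exact zero_le
  have h5 : (q * v) * (q * v) ≤ (q * v) * (4 * Q * X) := by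
    calc (q * v) * (q * v) ≤ (q * (2 * volume E)) * (q * (2 * volume E)) := by gcongr
      _ = 4 * (volume E * q) ^ 2 := by ring
      _ ≤ 4 * (volume E * ‖inner ℂ e (act A e)‖ₑ) ^ 2 := by gcongr
      _ ≤ 4 * (X * (Q * q * v)) := by gcongr 4 * ?_; exact h.trans (by gcongr)
      _ = _ := by ring
  exact (ENNReal.mul_le_mul_iff_right h0 (ENNReal.mul_ne_top hqtop hvtop)).1 h5

lemma lintegral_normalizedTrace_le_of_subset {E : Set ℝ} (hE : E ⊆ Set.Ico a b)
    (hvol : volume (Set.Ico a b) ≤ 2 * volume E) (I : Set ℝ) :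
    ∫⁻ y in Set.Ico a b, normalizedTrace V I y ≤ 4 * Q * ∫⁻ y in E, normalizedTrace V I y := by
  simp only [normalizedTrace]
  rw [lintegral_finsetSum' _ fun i _ => (hV.aemeasurable_ofReal_quadForm _).restrict,
    lintegral_finsetSum' _ fun i _ => (hV.aemeasurable_ofReal_quadForm _).restrict, Finset.mul_sum]
  exact Finset.sum_le_sum fun i _ =>
    hV.lintegral_quadForm_le_of_subset hV' hab hQ hE hvol _

end IsMatrixWeight

end MatrixWeight

end

noncomputable section

namespace MatrixWeight

open scoped ComplexOrder MatrixOrder Matrix.Norms.L2Operator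

variable {d : ℕ}

/-! ### The dyadic partitions -/

lemma mem_dyadic_iff {n k : ℤ} {x : ℝ} : x ∈ dyadic n k ↔ ⌊x / 2 ^ n⌋ = k := by
  have h : (0 : ℝ) < 2 ^ n := by positivity
  rw [Int.floor_eq_iff, le_div_iff₀ h, div_lt_iff₀ h]
  rfl

lemma dyadic_lt (n k : ℤ) : (k : ℝ) * 2 ^ n < ((k : ℝ) + 1) * 2 ^ n := by
  have h : (0 : ℝ) < 2 ^ n := by positivity
  nlinarith

/-- The partitions of `ℝ` into dyadic intervals of length at most `2 ^ N`. -/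
def dyadicPartition (N : ℤ) : NestedPartition (volume : Measure ℝ) where
  idx m x := ⌊x / 2 ^ (N - m)⌋
  measurable_idx m := Int.measurable_floor.comp (measurable_id.div_const _)
  nested m x y h := by
    have key : ∀ z : ℝ, ⌊z / 2 ^ (N - m)⌋ = ⌊z / 2 ^ (N - (m + 1 : ℕ))⌋ / (2 : ℕ) := fun z => by
      rw [← Int.floor_div_natCast, div_div]
      congr 2
      rw [show N - (m : ℤ) = (N - ((m + 1 : ℕ) : ℤ)) + 1 by push_cast; ring,
        zpow_add_one₀ two_ne_zero]
      norm_num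
    rw [key x, key y, h]
  pos m c := by
    have : (fun x : ℝ => ⌊x / 2 ^ (N - m)⌋) ⁻¹' {c} = dyadic (N - m) c := by
      ext x; exact mem_dyadic_iff.symm
    rw [this, dyadic, Real.volume_Ico]
    simpa using dyadic_lt (N - m) c
  lt_top m c := by
    have : (fun x : ℝ => ⌊x / 2 ^ (N - m)⌋) ⁻¹' {c} = dyadic (N - m) c := by
      ext x; exact mem_dyadic_iff.symm
    rw [this, dyadic, Real.volume_Ico]
    exact ENNReal.ofReal_ne_top

lemma cell_dyadicPartition (N : ℤ) (m : ℕ) (c : ℤ) :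
    (dyadicPartition N).cell m c = dyadic (N - m) c := by
  ext x
  exact mem_dyadic_iff.symm

/-! ### The pointwise bounds -/

lemma enorm_act_integral_le {α : Type*} [MeasurableSpace α] (ν : Measure α)
    (M : Matrix (Fin d) (Fin d) ℂ) (g : α → EuclideanSpace ℂ (Fin d)) :
    ‖act M (∫ y, g y ∂ν)‖ₑ ≤ ∫⁻ y, ‖act M (g y)‖ₑ ∂ν := by
  by_cases hg : Integrable g ν
  · have h := (Matrix.toEuclideanCLM (𝕜 := ℂ) M).integral_comp_comm hg
    change ∫ y, act M (g y) ∂ν = act M (∫ y, g y ∂ν) at h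
    rw [← h]
    exact enorm_integral_le_lintegral_enorm _
  -- A non-integrable function has Bochner integral zero by convention, so the left side vanishes.
  · rw [integral_undef hg]
    simp [act]

lemma enorm_act_average_le (V : ℝ → Matrix (Fin d) (Fin d) ℂ)
    (f : ℝ → EuclideanSpace ℂ (Fin d)) (M : Matrix (Fin d) (Fin d) ℂ) (I : Set ℝ) :
    ‖act M (⨍ y in I, act (CFC.sqrt (V y)) (f y))‖ₑ ≤
      ⨍⁻ y in I, ‖act (M * CFC.sqrt (V y)) (f y)‖ₑ ∂volume := by
  simp only [average, laverage, act_mul]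
  exact enorm_act_integral_le _ _ _

/-- Move the norm inside the average and use $\langle W\rangle^{-1}\le\langle W^{-1}\rangle$; the
inverse root of $W^{-1}$ is $W^{1/2}$ almost everywhere. -/
theorem maximalFn_le_auxMaximalFn {W : ℝ → Matrix (Fin d) (Fin d) ℂ} (hW : IsMatrixWeight W)
    (hW' : IsMatrixWeight fun x => (W x)⁻¹) (f : ℝ → EuclideanSpace ℂ (Fin d)) (x : ℝ) :
    maximalFn W f x ≤ auxMaximalFn (fun y => (W y)⁻¹) f x := by
  refine iSup₂_le fun n k => ?_
  by_cases hx : x ∈ dyadic n k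
  · rw [Set.indicator_of_mem hx]
    refine le_trans ?_ (le_iSup₂_of_le n k (le_iSup_of_le hx le_rfl))
    refine (enorm_act_average_le _ _ _ _).trans (laverage_mono_ae (ae_restrict_of_ae ?_))
    filter_upwards [hW.posDef] with y hy
    rw [inv_sqrt_inv hy, act_mul, act_mul, ← ofReal_norm, ← ofReal_norm]
    exact ENNReal.ofReal_le_ofReal (hW.norm_act_sqrt_matAvg_inv_le hW' (dyadic_lt n k) _)
  · rw [Set.indicator_of_notMem hx]
    exact zero_le

lemma measurable_maximalFn (V : ℝ → Matrix (Fin d) (Fin d) ℂ)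
    (f : ℝ → EuclideanSpace ℂ (Fin d)) : Measurable (maximalFn V f) :=
  Measurable.iSup fun _ => Measurable.iSup fun _ => measurable_const.indicator measurableSet_Ico

/-- The dyadic average of the product of the Hilbert–Schmidt norm of
`⟨V⟩_I ^ (-1/2) * V ^ (1/2)` and the norm of `f`. -/
def traceAvg (V : ℝ → Matrix (Fin d) (Fin d) ℂ) (f : ℝ → EuclideanSpace ℂ (Fin d))
    (n k : ℤ) : ℝ≥0∞ :=
  ⨍⁻ y in dyadic n k, normalizedTrace V (dyadic n k) y ^ (1 / 2 : ℝ) * ‖f y‖ₑ ∂volume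

lemma maximalFn_le_iSup_traceAvg {V : ℝ → Matrix (Fin d) (Fin d) ℂ} (hV : IsMatrixWeight V)
    (f : ℝ → EuclideanSpace ℂ (Fin d)) (x : ℝ) :
    maximalFn V f x ^ 2 ≤ ⨆ N : ℕ, ⨆ (m : ℕ) (_ : m < 2 * N + 1),
      traceAvg V f (N - m) ⌊x / 2 ^ ((N : ℤ) - m)⌋ ^ 2 := by
  have h : ∀ n k : ℤ, x ∈ dyadic n k →
      ‖act (CFC.sqrt (matAvg V (dyadic n k)))⁻¹
        (⨍ y in dyadic n k, act (CFC.sqrt (V y)) (f y))‖ₑ ^ 2 ≤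
      ⨆ N : ℕ, ⨆ (m : ℕ) (_ : m < 2 * N + 1),
        traceAvg V f (N - m) ⌊x / 2 ^ ((N : ℤ) - m)⌋ ^ 2 := by
    intro n k hx
    -- The interval of length $2^n$ appears in the window of scales from $2^N$ down to $2^{-N}$ with
    -- $N=|n|$, at depth $|n|-n\le2N$.
    have h1 : ((n.natAbs : ℕ) : ℤ) - ((n.natAbs - n).toNat : ℕ) = n := by omega
    refine le_iSup_of_le n.natAbs (le_iSup₂_of_le (n.natAbs - n).toNat (by omega) ?_)
    rw [h1, mem_dyadic_iff.1 hx]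
    gcongr
    refine (enorm_act_average_le _ _ _ _).trans (laverage_mono_ae (ae_restrict_of_ae ?_))
    filter_upwards [hV.enorm_act_le_normalizedTrace (dyadic n k)] with y hy
    exact hy (f y)
  have h2 : maximalFn V f x ≤ (⨆ N : ℕ, ⨆ (m : ℕ) (_ : m < 2 * N + 1),
      traceAvg V f (N - m) ⌊x / 2 ^ ((N : ℤ) - m)⌋ ^ 2) ^ (2 : ℝ)⁻¹ := by
    refine iSup₂_le fun n k => ?_
    by_cases hx : x ∈ dyadic n k
    · rw [Set.indicator_of_mem hx, ENNReal.le_rpow_inv_iff two_pos]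
      exact_mod_cast h n k hx
    · rw [Set.indicator_of_notMem hx]
      exact zero_le
  rw [ENNReal.le_rpow_inv_iff two_pos] at h2
  exact_mod_cast h2

/-- Enlarging the window from $N$ to $N'$ shifts depths by $N'-N$; this feeds monotone convergence.
-/
lemma monotone_iSup_traceAvg (V : ℝ → Matrix (Fin d) (Fin d) ℂ)
    (f : ℝ → EuclideanSpace ℂ (Fin d)) : Monotone fun (N : ℕ) (x : ℝ) =>
      ⨆ (m : ℕ) (_ : m < 2 * N + 1), traceAvg V f (N - m) ⌊x / 2 ^ ((N : ℤ) - m)⌋ ^ 2 := by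
  intro N N' hN x
  refine iSup₂_le fun m hm => ?_
  refine le_iSup₂_of_le (m + (N' - N)) (by omega) ?_
  have : (N' : ℤ) - ((m + (N' - N) : ℕ) : ℤ) = N - m := by omega
  rw [this]

/-! ### Matrix `A₂` weights -/

lemma eLpNorm_two_sq {ε : Type*} [TopologicalSpace ε] [ContinuousENorm ε] (g : ℝ → ε) :
    eLpNorm g 2 volume ^ 2 = ∫⁻ x, ‖g x‖ₑ ^ 2 := by
  have h := eLpNorm_nnreal_pow_eq_lintegral (μ := (volume : Measure ℝ)) (f := g) (p := 2)
    two_ne_zero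
  simpa using h

lemma enorm_sq_le_a2Char (V : ℝ → Matrix (Fin d) (Fin d) ℂ) {a b : ℝ} (hab : a < b) :
    ‖CFC.sqrt (matAvg V (Set.Ico a b)) *
      CFC.sqrt (matAvg (fun x => (V x)⁻¹) (Set.Ico a b))‖ₑ ^ 2 ≤ a2Char V :=
  le_iSup₂_of_le a b (le_iSup_of_le hab le_rfl)

namespace IsMatrixA2Weight

variable {V : ℝ → Matrix (Fin d) (Fin d) ℂ} (hV : IsMatrixA2Weight V)

include hV

lemma one_le_a2Char [NeZero d] : 1 ≤ a2Char V := by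
  refine le_trans ?_ (enorm_sq_le_a2Char V zero_lt_one)
  have h := hV.isMatrixWeight.one_le_norm_sqrt_mul_sqrt hV.isMatrixWeight_inv zero_lt_one
  have h' : (1 : ℝ≥0∞) ≤ ‖CFC.sqrt (matAvg V (Set.Ico 0 1)) *
      CFC.sqrt (matAvg (fun x => (V x)⁻¹) (Set.Ico 0 1))‖ₑ := by
    rw [← ofReal_norm, ← ENNReal.ofReal_one]
    exact ENNReal.ofReal_le_ofReal h
  exact one_le_pow₀ h'

lemma aemeasurable_rpow (I : Set ℝ) :
    AEMeasurable fun y => normalizedTrace V I y ^ (1 / 2 : ℝ) :=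
  (hV.isMatrixWeight.aemeasurable_normalizedTrace I).pow_const _

/-- A measurable version of the Hilbert–Schmidt norm of `⟨V⟩_I ^ (-1/2) * V ^ (1/2)`. -/
def traceNorm (n k : ℤ) : ℝ → ℝ≥0∞ := (hV.aemeasurable_rpow (dyadic n k)).mk _

lemma traceNorm_ae_eq (n k : ℤ) : ∀ᵐ y ∂(volume : Measure ℝ),
    normalizedTrace V (dyadic n k) y ^ (1 / 2 : ℝ) = hV.traceNorm n k y :=
  (hV.aemeasurable_rpow (dyadic n k)).ae_eq_mk

lemma traceNorm_sq_ae_eq (n k : ℤ) : ∀ᵐ y ∂(volume : Measure ℝ),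
    hV.traceNorm n k y ^ 2 = normalizedTrace V (dyadic n k) y := by
  filter_upwards [hV.traceNorm_ae_eq n k] with y hy
  rw [← hy, ← ENNReal.rpow_natCast, ← ENNReal.rpow_mul]
  norm_num

/-- The constants are $D=d$, from the Hilbert–Schmidt norm, and $Q=[V]_{A_2}$. Measurable
representatives of $\varphi_I$ are used because $V$ is only almost everywhere measurable. -/
lemma weightFamily [NeZero d] (N : ℤ) :
    (dyadicPartition N).WeightFamily d (a2Char V).toNNReal
      (fun m c => hV.traceNorm (N - m) c) (fun m c => dualTrace V (dyadic (N - m) c)) := by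
  have hQ : ((a2Char V).toNNReal : ℝ≥0∞) = a2Char V := ENNReal.coe_toNNReal hV.a2Char_lt_top.ne
  have hQ' : ∀ n k : ℤ, ‖CFC.sqrt (matAvg V (dyadic n k)) *
      CFC.sqrt (matAvg (fun x => (V x)⁻¹) (dyadic n k))‖ₑ ^ 2 ≤ (a2Char V).toNNReal :=
    fun n k => hQ ▸ enorm_sq_le_a2Char V (dyadic_lt n k)
  have hw := hV.isMatrixWeight
  have hw' := hV.isMatrixWeight_inv
  have hsq : ∀ (n k : ℤ) (E : Set ℝ), ∫⁻ y in E, hV.traceNorm n k y ^ 2 =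
      ∫⁻ y in E, normalizedTrace V (dyadic n k) y := fun n k E =>
    lintegral_congr_ae (ae_restrict_of_ae (hV.traceNorm_sq_ae_eq n k))
  refine ⟨fun m c => (hV.aemeasurable_rpow _).measurable_mk, ?_, ?_, fun m c => ?_,
    fun m c n c' E _ hE hvol => ?_, fun m c => ?_, fun m c n c' => ?_⟩
  · exact_mod_cast NeZero.one_le
  · rw [← ENNReal.coe_le_coe, hQ]; exact hV.one_le_a2Char
  · rw [cell_dyadicPartition, hsq]
    exact (hw.lintegral_normalizedTrace (dyadic_lt _ c)).le
  · rw [cell_dyadicPartition] at hE hvol ⊢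
    rw [hsq, hsq]
    exact hw.lintegral_normalizedTrace_le_of_subset hw' (dyadic_lt _ c') (hQ' _ _) hE hvol _
  · rw [cell_dyadicPartition]
    exact hw'.laverage_dualTrace_self_le (dyadic_lt _ c) (hQ' _ _)
  · rw [cell_dyadicPartition]
    filter_upwards [hV.traceNorm_sq_ae_eq (N - m) c, hV.traceNorm_sq_ae_eq (N - n) c',
      hw.normalizedTrace_le hw' (dyadic_lt (N - m) c) (dyadic_lt (N - n) c')] with y h1 h2 h3
    rw [h1, h2]
    exact h3

lemma lintegral_iSup_traceAvg_le [NeZero d] {f : ℝ → EuclideanSpace ℂ (Fin d)}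
    (hf : AEStronglyMeasurable f) (N M : ℕ) :
    ∫⁻ x : ℝ, ⨆ (m : ℕ) (_ : m < M), traceAvg V f (N - m) ⌊x / 2 ^ ((N : ℤ) - m)⌋ ^ 2 ≤
      (32 * d * a2Char V) ^ 2 * ∫⁻ x, ‖f x‖ₑ ^ 2 := by
  set F := hf.enorm.mk _ with hF
  have hFm : Measurable F := hf.enorm.measurable_mk
  have hFe : ∀ᵐ y ∂(volume : Measure ℝ), ‖f y‖ₑ = F y := hf.enorm.ae_eq_mk
  have h := (hV.weightFamily N).lintegral_iSup_cellAvg_sq_le hFm M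
  have hQ : ((a2Char V).toNNReal : ℝ≥0∞) = a2Char V := ENNReal.coe_toNNReal hV.a2Char_lt_top.ne
  have hF2 : ∫⁻ x, F x ^ 2 = ∫⁻ x, ‖f x‖ₑ ^ 2 := by
    refine lintegral_congr_ae ?_
    filter_upwards [hFe] with y hy
    rw [hy]
  rw [hQ, hF2] at h
  refine le_trans (le_of_eq ?_) h
  refine lintegral_congr fun x => iSup_congr fun m => iSup_congr fun _ => ?_
  congr 1
  rw [NestedPartition.WeightFamily.cellAvg, cell_dyadicPartition]
  refine laverage_congr (ae_restrict_of_ae ?_)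
  filter_upwards [hFe, hV.traceNorm_ae_eq (N - m) ⌊x / 2 ^ ((N : ℤ) - m)⌋] with y h1 h2
  rw [h1, h2]
  rfl

theorem lintegral_maximalFn_sq_le [NeZero d] {f : ℝ → EuclideanSpace ℂ (Fin d)}
    (hf : AEStronglyMeasurable f) :
    ∫⁻ x, maximalFn V f x ^ 2 ≤ (32 * d * a2Char V) ^ 2 * ∫⁻ x, ‖f x‖ₑ ^ 2 := by
  refine (lintegral_mono (maximalFn_le_iSup_traceAvg hV.isMatrixWeight f)).trans ?_
  rw [lintegral_iSup _ (monotone_iSup_traceAvg V f)]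
  · exact iSup_le fun N => hV.lintegral_iSup_traceAvg_le hf N (2 * N + 1)
  · intro N
    refine Measurable.iSup fun m => Measurable.iSup fun _ => ?_
    exact ((dyadicPartition N).measurable_comp_idx m fun c => traceAvg V f (N - m) c).pow_const 2

theorem eLpNorm_maximalFn_le {f : ℝ → EuclideanSpace ℂ (Fin d)} (hf : AEStronglyMeasurable f) :
    eLpNorm (maximalFn V f) 2 volume ≤ 32 * d * a2Char V * eLpNorm f 2 volume := by
  -- In dimension zero the bound $[V]_{A_2}\ge1$ is unavailable, but the maximal function vanishes.
  rcases Nat.eq_zero_or_pos d with rfl | hd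
  · have : maximalFn V f = 0 := by
      funext x
      refine le_antisymm (iSup₂_le fun n k => ?_) zero_le
      refine Set.indicator_apply_le' (fun _ => ?_) fun _ => zero_le
      rw [Subsingleton.elim (act _ _) 0]
      simp
    rw [this]
    simp
  · have : NeZero d := ⟨hd.ne'⟩
    refine (ENNReal.pow_le_pow_left_iff two_ne_zero).1 ?_
    rw [mul_pow, eLpNorm_two_sq, eLpNorm_two_sq]
    exact hV.lintegral_maximalFn_sq_le hf

end IsMatrixA2Weight

end MatrixWeight

end

theorem corollary2p2 (d : ℕ) :
    (∃ C : ℝ≥0, ∀ V : ℝ → Matrix (Fin d) (Fin d) ℂ, MatrixWeight.IsMatrixA2Weight V →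
      ∀ f : ℝ → EuclideanSpace ℂ (Fin d), MemLp f 2 volume →
        MemLp (MatrixWeight.maximalFn V f) 2 volume ∧
        eLpNorm (MatrixWeight.maximalFn V f) 2 volume ≤
          (C : ℝ≥0∞) * MatrixWeight.a2Char V * eLpNorm f 2 volume) ∧
    (∀ W : ℝ → Matrix (Fin d) (Fin d) ℂ,
      MatrixWeight.IsMatrixWeight W → MatrixWeight.IsMatrixWeight (fun x => (W x)⁻¹) →
      ∀ f : ℝ → EuclideanSpace ℂ (Fin d), MemLp f 2 volume →
        ∀ x : ℝ, MatrixWeight.maximalFn W f x ≤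
          MatrixWeight.auxMaximalFn (fun y => (W y)⁻¹) f x) := by
  refine ⟨⟨32 * d, fun V hV f hf => ?_⟩,
    fun W hW hW' f _ x => MatrixWeight.maximalFn_le_auxMaximalFn hW hW' f x⟩
  have h := hV.eLpNorm_maximalFn_le hf.aestronglyMeasurable
  refine ⟨⟨(MatrixWeight.measurable_maximalFn V f).aestronglyMeasurable, ?_⟩, ?_⟩
  · refine h.trans_lt (ENNReal.mul_lt_top (ENNReal.mul_lt_top ?_ hV.a2Char_lt_top) hf.2)
    exact ENNReal.mul_lt_top (by simp) (by simp)
  · exact_mod_cast h
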